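/- Let $\mathbb{D}=\{z\in\mathbb{C}:|z|<1\}$, let $\lambda>0$, and let $f$ be analytic in $\mathbb{D}$ with $f'(z)\neq 0$ for all $z\in\mathbb{D}$. For $z\in\mathbb{D}$ define $\Phi_n(f;z)$, $n\ge 0$, by the expansion, for $w$ near $z$, $$\left[\frac{f'(z)(w-z)}{f(w)-f(z)}\right]^{\lambda}=\sum_{n=0}^{\infty}\Phi_{n}(f;z)(w-z)^n ,$$ where the quotient is given the value $1$ at $w=z$ and the branch of the power is the analytic one that equals $1$ at $w=z$. For real $\alpha$ and an integer $m\ge 0$ put $\binom{\alpha}{m}=\frac{\alpha(\alpha-1)\cdots(\alpha-m+1)}{m!}$, with $\binom{\alpha}{0}=1$, and use the convention $0^0=1$. Then the following are equivalent: (i) $f$ is univalent (that is, one-to-one) in $\mathbb{D}$, and it is a full mapping, that is, $\mathbb{C}\setminus f(\mathbb{D})$ has Lebesgue measure zero; (ii) for every $\zeta\in\mathbb{D}$ the following series converges and $$\sum_{n=1}^{\infty}(n-\lambda)\left|\sum_{j=0}^{n}(-1)^{n-j}\binom{\lambda}{n-j}\sum_{k=0}^{j}\binom{j-1}{j-k}(-\bar{\zeta})^{n-k}(1-|\zeta|^2)^{k}\,\Phi_{k}(f;\zeta)\right|^2=\lambda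 .$$ -/

import Mathlib

namespace PrawitzCriterion

noncomputable section

open Metric MeasureTheory

/-- The open unit disk of `ℂ`. -/
def disk : Set ℂ := ball 0 1

/-- `f` is locally univalent analytic in the unit disk. -/
def LocallyUnivalent (f : ℂ → ℂ) : Prop :=
  AnalyticOnNhd ℂ f disk ∧ ∀ z ∈ disk, deriv f z ≠ 0

/-- `f` is univalent analytic in the unit disk. -/
def Univalent (f : ℂ → ℂ) : Prop :=
  AnalyticOnNhd ℂ f disk ∧ Set.InjOn f disk

/-- `f` is a full mapping: the complement of `f(𝔻)` in the plane has Lebesgue measure zero. -/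
def FullMapping (f : ℂ → ℂ) : Prop :=
  volume (f '' disk)ᶜ = 0

/-- `w ↦ f'(z) (w - z) / (f(w) - f(z))`, with its limit value `1` at `w = z`. -/
def kernel (f : ℂ → ℂ) (z w : ℂ) : ℂ :=
  if w = z then 1 else deriv f z * (w - z) / (f w - f z)

/-- The `n`-th Taylor coefficient at `w = z` of the generating function
`w ↦ [f'(z) (w - z) / (f(w) - f(z))] ^ lam`. The base is near `1` for `w` near `z`, so the principal
power is there the analytic branch which takes the value `1` at `w = z`. -/
def Phi (lam : ℝ) (n : ℕ) (f : ℂ → ℂ) (z : ℂ) : ℂ :=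
  iteratedDeriv n (fun w => kernel f z w ^ (lam : ℂ)) z / (n.factorial : ℂ)

/-- The generalized binomial coefficient `a (a - 1) ⋯ (a - m + 1) / m!`. -/
def binom (a : ℝ) (m : ℕ) : ℝ :=
  (∏ i ∈ Finset.range m, (a - i)) / (m.factorial : ℝ)

/-- The finite double sum
`∑_{j ≤ n} (-1)^(n-j) C(lam, n-j) ∑_{k ≤ j} C(j-1, j-k) (-ζ̄)^(n-k) (1-|ζ|²)^k Φ_k(f; ζ)`;
here `C(j-1, j-k)` is a generalized binomial coefficient, equal to `C(-1, 0) = 1` for `j = 0`. -/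
def prawitzCoeff (lam : ℝ) (f : ℂ → ℂ) (ζ : ℂ) (n : ℕ) : ℂ :=
  ∑ j ∈ Finset.range (n + 1), (-1) ^ (n - j) * (binom lam (n - j) : ℂ) *
    ∑ k ∈ Finset.range (j + 1), (binom ((j : ℝ) - 1) (j - k) : ℂ) *
      (-(starRingEnd ℂ ζ)) ^ (n - k) * (1 - (‖ζ‖ : ℂ) ^ 2) ^ k * Phi lam k f ζ

end

end PrawitzCriterion

open Metric MeasureTheory Filter Topology Finset

namespace PrawitzCriterion

/-! Let `F` be the Koebe transform of `f` at `ζ`, normalized by F(0) = 0 and F'(0) = 1.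
Vandermonde's identity collapses the double sum: `prawitzCoeff` is the Taylor coefficient a_n of (z
/ F(z))^λ (`prawitzCoeff_eq_iteratedDeriv`, `prawitzCoeff_eq_taylorCoeff`).

For univalent `f`, F = z exp(L) and (z / F)^λ = exp(-λL). Weight the plane by |w|^(-2(λ+1)),
flattened near 0. Green's formula and Parseval on |z| = r express the weighted area of F(|z| < r)
through ∑ (n - λ)|a_n|² r^(2n). As r → 1 this gives ∑_{n≥0} (n - λ)|a_n|² = -I, where I is a
positive multiple of the weighted area outside the image (`exists_hasSum_area`). Since a_0 = 1, the
sum over n ≥ 1 is λ - I, and I = 0 exactly for full mappings.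

Conversely, convergence of the series alone forces univalence. It bounds the a_n, so their power
series H is holomorphic on the disk and equals p^(-λ) near 0, where p = F / z. The identity theorem
spreads λp'H + pH' = 0 to the disk, and comparing orders of vanishing excludes zeros of p
(`ne_zero_of_mul_deriv_add_eq_zero`). A second point where `f` takes the value f(ζ) would be such a
zero. -/

/-! ### Binomial identities collapsing the double sum. -/

theorem binom_eq_choose (a : ℝ) (m : ℕ) : binom a m = Ring.choose a m := by
  rw [binom, Ring.choose_eq_smul, smul_eq_mul, div_eq_inv_mul]
  congr 1
  induction m with
  | zero => simp
  | succ n ih =>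
    rw [Finset.prod_range_succ, ih, descPochhammer_succ_right, Polynomial.smeval_mul]
    simp [Polynomial.smeval_natCast]

theorem binom_sub_one_eq (k i : ℕ) :
    binom ((k + i : ℕ) - 1 : ℝ) i = (-1) ^ i * Ring.choose (-(k : ℝ)) i := by
  rw [binom_eq_choose, Ring.choose_neg, Units.smul_def, zsmul_eq_mul, ← mul_assoc]
  push_cast
  simp [← mul_pow]

/-- Vandermonde convolution in the form used by the double sum of the criterion. -/
theorem sum_binom_mul_binom (a : ℝ) (k m : ℕ) :
    ∑ i ∈ range (m + 1), (-1) ^ (m - i) * binom a (m - i) * binom ((k + i : ℕ) - 1 : ℝ) i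
      = (-1) ^ m * Ring.choose (a - k) m := by
  rw [sub_eq_neg_add, Ring.add_choose_eq m (Commute.all _ _),
    Nat.sum_antidiagonal_eq_sum_range_succ (fun i j => Ring.choose (-(k : ℝ)) i * Ring.choose a j),
    mul_sum]
  refine sum_congr rfl fun i hi => ?_
  have hi : i ≤ m := by simpa [Nat.lt_succ_iff] using hi
  rw [binom_sub_one_eq, binom_eq_choose]
  conv_rhs => rw [← Nat.sub_add_cancel hi, pow_add, Nat.sub_add_cancel hi]
  ring

/-- Summing over `j` first, with j = k + i, leaves a Vandermonde convolution for each `k`; its sign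
(-1)^(n-k) cancels the one in (-ζ̄)^(n-k). -/
theorem prawitzCoeff_eq_sum (lam : ℝ) (f : ℂ → ℂ) (ζ : ℂ) (n : ℕ) :
    prawitzCoeff lam f ζ n = ∑ k ∈ range (n + 1), Phi lam k f ζ * (1 - (‖ζ‖ : ℂ) ^ 2) ^ k *
      (Ring.choose ((lam : ℂ) - k) (n - k) * (starRingEnd ℂ ζ) ^ (n - k)) := by
  have h1 : prawitzCoeff lam f ζ n = ∑ j ∈ range (n + 1), ∑ k ∈ range (j + 1),
      (-1) ^ (n - j) * (binom lam (n - j) : ℂ) * ((binom ((j : ℝ) - 1) (j - k) : ℂ) *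
      (-(starRingEnd ℂ ζ)) ^ (n - k) * (1 - (‖ζ‖ : ℂ) ^ 2) ^ k * Phi lam k f ζ) := by
    simp only [prawitzCoeff, mul_sum]
  rw [h1, Finset.sum_comm' (t' := range (n + 1)) (s' := fun k => Finset.Ico k (n + 1))
    (by intro x y; simp only [mem_range, Finset.mem_Ico]; omega)]
  refine sum_congr rfl fun k hk => ?_
  have hk : k ≤ n := by simpa [Nat.lt_succ_iff] using hk
  have h2 := congrArg (fun x : ℝ => (x : ℂ)) (sum_binom_mul_binom lam k (n - k))
  push_cast at h2
  rw [Finset.sum_Ico_eq_sum_range, show n + 1 - k = n - k + 1 by omega]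
  have h3 : (Ring.choose ((lam : ℂ) - k) (n - k) * (starRingEnd ℂ ζ) ^ (n - k)) =
      ((-1) ^ (n - k) * Ring.choose ((lam : ℂ) - k) (n - k)) * (-(starRingEnd ℂ ζ)) ^ (n - k) := by
    rw [neg_pow (starRingEnd ℂ ζ)]
    have : ((-1 : ℂ) ^ (n - k)) * (-1) ^ (n - k) = 1 := by rw [← mul_pow]; simp
    linear_combination (-Ring.choose ((lam : ℂ) - k) (n - k) * (starRingEnd ℂ ζ) ^ (n - k)) * this
  rw [h3, ← h2, Finset.sum_mul, Finset.mul_sum]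
  refine sum_congr rfl fun i hi => ?_
  rw [show n - (k + i) = n - k - i by omega, show k + i - k = i by omega]
  push_cast
  ring

/-! ### Taylor coefficients under a Möbius substitution. -/

/-- Taylor coefficients at the origin. -/
theorem iteratedDeriv_pow_mul {g : ℂ → ℂ} (hg : AnalyticAt ℂ g 0) (n k : ℕ) :
    iteratedDeriv n (fun z => z ^ k * g z) 0 / n.factorial =
      if k ≤ n then iteratedDeriv (n - k) g 0 / (n - k).factorial else 0 := by
  rw [iteratedDeriv_fun_mul (by fun_prop) hg.contDiffAt]
  simp only [iteratedDeriv_fun_pow_zero]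
  split_ifs with h
  · rw [Finset.sum_eq_single k]
    · simp only [if_true]
      have hfac (m : ℕ) : (m.factorial : ℂ) ≠ 0 := by exact_mod_cast m.factorial_ne_zero
      rw [div_eq_div_iff (hfac _) (hfac _), ← Nat.choose_mul_factorial_mul_factorial h]
      push_cast; ring
    · intro b _ hb; simp [hb]
    · intro hk; simp at hk; omega
  · rw [Finset.sum_eq_zero, zero_div]
    intro x hx
    have : x ≠ k := by simp at hx; omega
    simp [this]

theorem iteratedDeriv_one_add_mul_cpow (a c : ℂ) (n : ℕ) :
    iteratedDeriv n (fun z => (1 + c * z) ^ a) 0 / n.factorial = Ring.choose a n * c ^ n := by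
  have h1 := (Complex.one_add_cpow_hasFPowerSeriesAt_zero (a := a))
  have h2 := hasFPowerSeriesAt_iff.1 h1
  have han : AnalyticAt ℂ (fun z => (1 + c * z) ^ a) 0 := by
    refine AnalyticAt.cpow (by fun_prop) analyticAt_const (by simp)
  have h3 : HasFPowerSeriesAt (fun z => (1 + c * z) ^ a)
      (FormalMultilinearSeries.ofScalars ℂ fun n => Ring.choose a n * c ^ n) 0 := by
    rw [hasFPowerSeriesAt_iff]
    have ht : Tendsto (fun z : ℂ => c * z) (𝓝 0) (𝓝 0) := by
      have : Continuous (fun z : ℂ => c * z) := by fun_prop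
      simpa using this.tendsto 0
    filter_upwards [ht.eventually h2] with z hz
    simpa [binomialSeries, FormalMultilinearSeries.coeff_ofScalars, mul_pow, mul_assoc,
      mul_comm, mul_left_comm] using hz
  have h4 := han.hasFPowerSeriesAt.eq_formalMultilinearSeries h3
  have h5 := congrArg (fun p => FormalMultilinearSeries.coeff p n) h4
  simpa [FormalMultilinearSeries.coeff_ofScalars] using h5

/-- Substituting the Taylor polynomial of `g`, each power u^k becomes s^k z^k (1 + cz)^(a-k), which
the binomial series expands. The remainder is divisible by z^(n+1) and does not reach order `n`. -/
theorem iteratedDeriv_one_add_mul_cpow_mul_comp {g : ℂ → ℂ} (hg : AnalyticAt ℂ g 0)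
    (a c s : ℂ) (n : ℕ) :
    iteratedDeriv n (fun z => (1 + c * z) ^ a * g (s * z / (1 + c * z))) 0 / n.factorial =
      ∑ k ∈ range (n + 1), iteratedDeriv k g 0 / k.factorial * s ^ k *
        (Ring.choose (a - k) (n - k) * c ^ (n - k)) := by
  obtain ⟨R, hR, hgR⟩ := hg.exists_eq_sum_add_pow_mul (n + 1)
  have hone : ∀ᶠ z : ℂ in 𝓝 0, 1 + c * z ≠ 0 := by
    have : ContinuousAt (fun z : ℂ => 1 + c * z) 0 := by fun_prop
    exact this.eventually_ne (by simp)
  have hpow (b : ℂ) : AnalyticAt ℂ (fun z => (1 + c * z) ^ b) 0 :=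
    AnalyticAt.cpow (by fun_prop) analyticAt_const (by simp)
  have hin : AnalyticAt ℂ (fun z => s * z / (1 + c * z)) 0 :=
    AnalyticAt.fun_div (by fun_prop) (by fun_prop) (by simp)
  have hRc : AnalyticAt ℂ (fun z => R (s * z / (1 + c * z))) 0 :=
    AnalyticAt.comp_of_eq (g := R) (f := fun z => s * z / (1 + c * z)) hR hin (by simp)
  let T : ℕ → ℂ → ℂ := fun k z =>
    z ^ k * (iteratedDeriv k g 0 / k.factorial * s ^ k * (1 + c * z) ^ (a - k))
  let E : ℂ → ℂ := fun z =>
    z ^ (n + 1) * (s ^ (n + 1) * (1 + c * z) ^ (a - (n + 1 : ℕ)) * R (s * z / (1 + c * z)))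
  have hE : AnalyticAt ℂ E 0 := by
    exact (analyticAt_id.fun_pow _).fun_mul ((analyticAt_const.fun_mul (hpow _)).fun_mul hRc)
  have hT (k : ℕ) : AnalyticAt ℂ (T k) 0 := by
    have := hpow (a - k); fun_prop
  have heq : (fun z => (1 + c * z) ^ a * g (s * z / (1 + c * z))) =ᶠ[𝓝 0]
      fun z => (∑ k ∈ range (n + 1), T k z) + E z := by
    filter_upwards [hone] with z hz
    rw [hgR, mul_add, Finset.mul_sum]
    congr 1
    · refine sum_congr rfl fun k _ => ?_
      simp only [T]
      rw [Complex.cpow_sub _ _ hz, Complex.cpow_natCast, smul_eq_mul, div_pow, mul_pow]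
      ring
    · simp only [E]
      rw [Complex.cpow_sub _ _ hz, Complex.cpow_natCast, smul_eq_mul, div_pow, mul_pow]
      ring
  rw [heq.iteratedDeriv_eq, iteratedDeriv_fun_add
    (Finset.analyticAt_fun_sum _ fun k _ => hT k).contDiffAt hE.contDiffAt,
    iteratedDeriv_fun_sum fun k _ => (hT k).contDiffAt, add_div, Finset.sum_div]
  have hE0 : iteratedDeriv n E 0 / n.factorial = 0 := by
    simp only [E]
    rw [iteratedDeriv_pow_mul ((analyticAt_const.fun_mul (hpow _)).fun_mul hRc), if_neg (by omega)]
  rw [hE0, add_zero]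
  refine sum_congr rfl fun k hk => ?_
  have hk : k ≤ n := by simpa [Nat.lt_succ_iff] using hk
  have := hpow (a - k)
  simp only [T]
  rw [iteratedDeriv_pow_mul (by fun_prop), if_pos hk, iteratedDeriv_const_mul_field, mul_div_assoc,
    iteratedDeriv_one_add_mul_cpow]

theorem kernel_eq_div_dslope {f : ℂ → ℂ} {ζ : ℂ} (h : deriv f ζ ≠ 0) (w : ℂ) :
    kernel f ζ w = deriv f ζ / dslope f ζ w := by
  rcases eq_or_ne w ζ with rfl | hw
  · simp [kernel, h]
  · rw [kernel, if_neg hw, dslope_of_ne _ hw, slope_def_field, div_div_eq_mul_div]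

theorem analyticAt_kernel_cpow {f : ℂ → ℂ} {ζ : ℂ} (hf : AnalyticAt ℂ f ζ) (h : deriv f ζ ≠ 0)
    (a : ℂ) : AnalyticAt ℂ (fun w => kernel f ζ w ^ a) ζ := by
  obtain ⟨p, hp⟩ := hf
  have hd : AnalyticAt ℂ (dslope f ζ) ζ := ⟨_, hp.has_fpower_series_dslope_fslope⟩
  simp only [kernel_eq_div_dslope h]
  refine AnalyticAt.cpow (analyticAt_const.fun_div hd (by simpa)) analyticAt_const ?_
  simp [h]

/-- The double sum is a Taylor coefficient of the generating function transported by a disk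
automorphism. -/
theorem prawitzCoeff_eq_iteratedDeriv (lam : ℝ) {f : ℂ → ℂ} {ζ : ℂ} (hf : AnalyticAt ℂ f ζ)
    (h : deriv f ζ ≠ 0) (n : ℕ) :
    prawitzCoeff lam f ζ n = iteratedDeriv n (fun z => (1 + starRingEnd ℂ ζ * z) ^ (lam : ℂ) *
      kernel f ζ (ζ + (1 - (‖ζ‖ : ℂ) ^ 2) * z / (1 + starRingEnd ℂ ζ * z)) ^ (lam : ℂ)) 0
        / n.factorial := by
  have hg : AnalyticAt ℂ (fun u => kernel f ζ (ζ + u) ^ (lam : ℂ)) 0 :=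
    AnalyticAt.comp_of_eq (g := fun w => kernel f ζ w ^ (lam : ℂ)) (f := fun u => ζ + u)
      (analyticAt_kernel_cpow hf h lam) (by fun_prop) (by simp)
  rw [iteratedDeriv_one_add_mul_cpow_mul_comp hg, prawitzCoeff_eq_sum]
  refine sum_congr rfl fun k _ => ?_
  rw [iteratedDeriv_comp_const_add k (fun w => kernel f ζ w ^ (lam : ℂ)) ζ]
  simp [Phi]

/-! ### Green's formula on circles. -/

section

theorem hasDerivAt_integral_of_continuousOn_deriv {U V : ℝ → ℝ → ℂ} {a b c d t₀ : ℝ}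
    (ht : t₀ ∈ Set.Ioo a b) (hU : ∀ t ∈ Set.Ioo a b, Continuous (U t))
    (hV : ContinuousOn V.uncurry (Set.Ioo a b ×ˢ Set.univ))
    (hd : ∀ t ∈ Set.Ioo a b, ∀ x, HasDerivAt (fun t => U t x) (V t x) t) :
    HasDerivAt (fun t => ∫ x in c..d, U t x) (∫ x in c..d, V t₀ x) t₀ := by
  obtain ⟨ε, hε, hsub⟩ : ∃ ε > 0, closedBall t₀ ε ⊆ Set.Ioo a b :=
    nhds_basis_closedBall.mem_iff.1 (Ioo_mem_nhds ht.1 ht.2)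
  have hcomp : IsCompact (closedBall t₀ ε ×ˢ Set.uIcc c d) :=
    (isCompact_closedBall _ _).prod isCompact_uIcc
  obtain ⟨C, hC⟩ := hcomp.exists_bound_of_continuousOn
    (hV.mono (Set.prod_mono hsub (Set.subset_univ _)))
  have hVt : Continuous (V t₀) := by
    rw [← continuousOn_univ]
    exact hV.comp (f := fun x => (t₀, x)) (by fun_prop) fun x _ => ⟨ht, trivial⟩
  refine (intervalIntegral.hasDerivAt_integral_of_dominated_loc_of_deriv_le (bound := fun _ => C)
    (closedBall_mem_nhds t₀ hε) ?_ ((hU t₀ ht).intervalIntegrable _ _)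
    hVt.aestronglyMeasurable ?_ (by simp) ?_).2
  · filter_upwards [Ioo_mem_nhds ht.1 ht.2] with t ht'
    exact (hU t ht').aestronglyMeasurable
  · refine Eventually.of_forall fun x hx t ht' => hC (t, x) ⟨ht', Set.uIoc_subset_uIcc hx⟩
  · exact Eventually.of_forall fun x _ t ht' => hd t (hsub ht') x

theorem continuousOn_integral_of_continuousOn {U : ℝ → ℝ → ℂ} {s : Set ℝ} {c d : ℝ}
    (hU : ContinuousOn U.uncurry (s ×ˢ Set.univ)) :
    ContinuousOn (fun t => ∫ x in c..d, U t x) s := by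
  rw [continuousOn_iff_continuous_domRestrict]
  refine intervalIntegral.continuous_parametric_intervalIntegral_of_continuous'
    (f := fun (t : s) x => U t x) ?_ c d
  have : Continuous fun p : s × ℝ => ((p.1 : ℝ), p.2) := by fun_prop
  exact hU.comp_continuous this fun p => ⟨p.1.2, trivial⟩

variable {L : ℂ → ℂ} {om m : ℝ → ℝ}

/-- Green's formula on a disk for a radial weight pulled back by `z ↦ z exp (L z)`. -/
theorem integral_weight_comp_eq_circle (hL : AnalyticOnNhd ℂ L (ball 0 1)) (hom : Continuous om)
    (hm : ∀ s, HasDerivAt m (om s) s) (hm0 : m 0 = 0) {r : ℝ} (hr0 : 0 ≤ r) (hr1 : r < 1) :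
    ∫ t in (0 : ℝ)..r, ∫ x in -Real.pi..Real.pi, ((2 * t * (om (‖(t * Complex.exp (x * Complex.I) : ℂ) *
        Complex.exp (L (t * Complex.exp (x * Complex.I)))‖ ^ 2) *
      ‖Complex.exp (L (t * Complex.exp (x * Complex.I))) * (1 + t * Complex.exp (x * Complex.I) *
        deriv L (t * Complex.exp (x * Complex.I)))‖ ^ 2) : ℝ) : ℂ) =
    ∫ x in -Real.pi..Real.pi, (m (‖(r * Complex.exp (x * Complex.I) : ℂ) *
        Complex.exp (L (r * Complex.exp (x * Complex.I)))‖ ^ 2) : ℂ) *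
      (1 + r * Complex.exp (x * Complex.I) * deriv L (r * Complex.exp (x * Complex.I))) := by
  set e : ℝ → ℂ := fun x => Complex.exp (x * Complex.I) with he
  set F : ℂ → ℂ := fun z => z * Complex.exp (L z) with hF
  set K : ℂ → ℂ := fun z => 1 + z * deriv L z with hK
  set D : ℂ → ℂ := fun z => Complex.exp (L z) * K z with hD
  have hLd : DifferentiableOn ℂ L (ball 0 1) := hL.differentiableOn
  have hL' : AnalyticOnNhd ℂ (deriv L) (ball 0 1) := hL.deriv
  have hKa : AnalyticOnNhd ℂ K (ball 0 1) := fun z hz =>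
    analyticAt_const.fun_add (analyticAt_id.fun_mul (hL' z hz))
  have hFd : ∀ z ∈ ball (0 : ℂ) 1, HasDerivAt F (D z) z := fun z hz => by
    have h1 := (hL z hz).differentiableAt.hasDerivAt
    refine ((hasDerivAt_id z).mul h1.cexp).congr_deriv ?_
    simp [D, K]; ring
  have hK'c : ContinuousOn (deriv K) (ball 0 1) := hKa.deriv.continuousOn
  have hKc : ContinuousOn K (ball 0 1) := hKa.continuousOn
  have hFc : ContinuousOn F (ball 0 1) := fun z hz => (hFd z hz).continuousAt.continuousWithinAt
  have hDc : ContinuousOn D (ball 0 1) := hLd.continuousOn.cexp.mul hKc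
  have hmc : Continuous m := continuous_iff_continuousAt.2 fun s => (hm s).continuousAt
  have he1 (x : ℝ) : ‖e x‖ = 1 := Complex.norm_exp_ofReal_mul_I x
  have hmem {t : ℝ} (ht0 : 0 ≤ t) (ht1 : t < 1) (x : ℝ) : (t : ℂ) * e x ∈ ball (0 : ℂ) 1 := by
    simp [he1, abs_of_nonneg ht0, ht1]
  have hec : Continuous e := by fun_prop
  have hmaps : Set.MapsTo (fun p : ℝ × ℝ => (p.1 : ℂ) * e p.2) (Set.Ico 0 1 ×ˢ Set.univ)
      (ball 0 1) := fun p hp => hmem hp.1.1 hp.1.2 p.2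
  have hzc : ContinuousOn (fun p : ℝ × ℝ => (p.1 : ℂ) * e p.2) (Set.Ico 0 1 ×ˢ Set.univ) := by
    fun_prop
  -- `U` is the boundary integrand, `V` and `W` its radial and angular derivatives, `J` the area
  -- density in polar coordinates.
  let U : ℝ → ℝ → ℂ := fun t x => (m (‖F (t * e x)‖ ^ 2) : ℂ) * K (t * e x)
  let V : ℝ → ℝ → ℂ := fun t x =>
    ((om (‖F (t * e x)‖ ^ 2) * (2 * inner ℝ (F (t * e x)) (D (t * e x) * e x)) : ℝ) : ℂ)
      * K (t * e x) + (m (‖F (t * e x)‖ ^ 2) : ℂ) * (deriv K (t * e x) * e x)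
  let W : ℝ → ℝ → ℂ := fun t x =>
    ((om (‖F (t * e x)‖ ^ 2) *
      (2 * inner ℝ (F (t * e x)) (D (t * e x) * (t * (e x * Complex.I)))) : ℝ) : ℂ)
      * K (t * e x) + (m (‖F (t * e x)‖ ^ 2) : ℂ) * (deriv K (t * e x) * (t * (e x * Complex.I)))
  let J : ℝ → ℝ → ℂ := fun t x => ((2 * t * (om (‖F (t * e x)‖ ^ 2) * ‖D (t * e x)‖ ^ 2) : ℝ) : ℂ)
  have cF := hFc.comp hzc hmaps
  have cK := hKc.comp hzc hmaps
  have cD := hDc.comp hzc hmaps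
  have cK' := hK'c.comp hzc hmaps
  have ce : ContinuousOn (fun p : ℝ × ℝ => e p.2) (Set.Ico 0 1 ×ˢ Set.univ) := by fun_prop
  have com : ContinuousOn (fun p : ℝ × ℝ => om (‖F (p.1 * e p.2)‖ ^ 2))
      (Set.Ico 0 1 ×ˢ Set.univ) := hom.comp_continuousOn (cF.norm.pow 2)
  have cm : ContinuousOn (fun p : ℝ × ℝ => m (‖F (p.1 * e p.2)‖ ^ 2))
      (Set.Ico 0 1 ×ˢ Set.univ) := hmc.comp_continuousOn (cF.norm.pow 2)
  have ofRealC : Continuous (fun s : ℝ => (s : ℂ)) := Complex.continuous_ofReal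
  have cU : ContinuousOn U.uncurry (Set.Ico 0 1 ×ˢ Set.univ) :=
    (ofRealC.comp_continuousOn cm).mul cK
  have cJ : ContinuousOn J.uncurry (Set.Ico 0 1 ×ˢ Set.univ) :=
    ofRealC.comp_continuousOn ((continuousOn_const.mul continuousOn_fst).mul
      (com.mul (cD.norm.pow 2)))
  have cV : ContinuousOn V.uncurry (Set.Ico 0 1 ×ˢ Set.univ) :=
    ((ofRealC.comp_continuousOn (com.mul (continuousOn_const.mul
      (ContinuousOn.inner (𝕜 := ℝ) cF (cD.mul ce))))).mul cK).add ((ofRealC.comp_continuousOn cm).mul (cK'.mul ce))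
  have ct : ContinuousOn (fun p : ℝ × ℝ => (p.1 : ℂ) * (e p.2 * Complex.I))
    (Set.Ico 0 1 ×ˢ Set.univ) := by fun_prop
  have cW : ContinuousOn W.uncurry (Set.Ico 0 1 ×ˢ Set.univ) :=
    ((ofRealC.comp_continuousOn (com.mul (continuousOn_const.mul
      (ContinuousOn.inner (𝕜 := ℝ) cF (cD.mul ct))))).mul cK).add ((ofRealC.comp_continuousOn cm).mul (cK'.mul ct))
  have slice {G : ℝ → ℝ → ℂ} (hG : ContinuousOn G.uncurry (Set.Ico 0 1 ×ˢ Set.univ)) {t : ℝ}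
      (ht : t ∈ Set.Ico (0 : ℝ) 1) : Continuous (G t) := by
    rw [← continuousOn_univ]
    exact hG.comp (f := fun x => (t, x)) (by fun_prop) fun x _ => ⟨ht, trivial⟩
  have along {γ : ℝ → ℂ} {γ' : ℂ} {u : ℝ} (hγ : HasDerivAt γ γ' u) (hu : γ u ∈ ball (0 : ℂ) 1) :
      HasDerivAt (fun u => (m (‖F (γ u)‖ ^ 2) : ℂ) * K (γ u))
        (((om (‖F (γ u)‖ ^ 2) * (2 * inner ℝ (F (γ u)) (D (γ u) * γ')) : ℝ) : ℂ) * K (γ u) +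
          (m (‖F (γ u)‖ ^ 2) : ℂ) * (deriv K (γ u) * γ')) u := by
    have h1 : HasDerivAt (fun u => F (γ u)) (D (γ u) * γ') u := (hFd _ hu).comp u hγ
    have h2 : HasDerivAt (fun u => K (γ u)) (deriv K (γ u) * γ') u :=
      (hKa _ hu).differentiableAt.hasDerivAt.comp u hγ
    exact (((hm _).comp u h1.norm_sq).ofReal_comp).mul h2
  have hVd : ∀ t ∈ Set.Ioo (0 : ℝ) 1, ∀ x, HasDerivAt (fun t => U t x) (V t x) t := by
    intro t ht x
    have hγ : HasDerivAt (fun t : ℝ => (t : ℂ) * e x) (e x) t := by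
      simpa using (hasDerivAt_id t).ofReal_comp.mul_const (e x)
    exact along hγ (hmem ht.1.le ht.2 x)
  have hWd : ∀ t ∈ Set.Ioo (0 : ℝ) 1, ∀ x, HasDerivAt (fun x => U t x) (W t x) x := by
    intro t ht x
    have hγ : HasDerivAt (fun x : ℝ => (t : ℂ) * e x) (t * (e x * Complex.I)) x := by
      have h0 : HasDerivAt (fun x : ℝ => (x : ℂ) * Complex.I) Complex.I x := by
        simpa using (hasDerivAt_id x).ofReal_comp.mul_const Complex.I
      exact h0.cexp.const_mul _
    exact along hγ (hmem ht.1.le ht.2 x)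
  -- V + (i/t)W is 2e^(-ix) ∂U/∂z̄. As `K` is holomorphic, ∂U/∂z̄ = om(|F|²) F conj(F') K, and FK =
  -- zF' turns this into `J`. The `W` term integrates to zero over a period.
  have key : ∀ t ∈ Set.Ioo (0 : ℝ) 1, ∀ x, V t x = J t x - Complex.I / t * W t x := by
    intro t ht x
    have ht0 : (t : ℂ) ≠ 0 := by exact_mod_cast ht.1.ne'
    have hFK : F (t * e x) * K (t * e x) = t * e x * D (t * e x) := by simp only [F, D]; ring
    have hee : e x * (starRingEnd ℂ) (e x) = 1 := by
      rw [Complex.mul_conj, Complex.normSq_eq_norm_sq, he1]; simp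
    set q : ℂ := starRingEnd ℂ (F (t * e x)) * (D (t * e x) * e x) with hq
    have i1 : inner ℝ (F (t * e x)) (D (t * e x) * e x) = q.re := by
      rw [Complex.inner, mul_comm]
    have i2 : inner ℝ (F (t * e x)) (D (t * e x) * (t * (e x * Complex.I))) = -(t * q.im) := by
      rw [Complex.inner, show D (t * e x) * (t * (e x * Complex.I)) * starRingEnd ℂ (F (t * e x))
        = (t : ℂ) * (q * Complex.I) by rw [hq]; ring, Complex.re_ofReal_mul, Complex.mul_I_re]
      ring
    have hqc : (q.re : ℂ) - q.im * Complex.I =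
        F (t * e x) * starRingEnd ℂ (D (t * e x)) * starRingEnd ℂ (e x) := by
      have : starRingEnd ℂ q = q.re - q.im * Complex.I := by
        apply Complex.ext <;> simp
      rw [← this, hq]; simp; ring
    have hDD : ((‖D (t * e x)‖ ^ 2 : ℝ) : ℂ) = D (t * e x) * starRingEnd ℂ (D (t * e x)) := by
      rw [Complex.mul_conj, Complex.normSq_eq_norm_sq]
    simp only [V, W, J]
    rw [i1, i2]
    push_cast
    push_cast at hDD
    rw [hDD]
    have hI : Complex.I * Complex.I = -1 := Complex.I_mul_I
    field_simp
    linear_combination (2 * (om (‖F (t * e x)‖ ^ 2) : ℂ) * K (t * e x)) * hqc +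
      (2 * (om (‖F (t * e x)‖ ^ 2) : ℂ) * starRingEnd ℂ (D (t * e x)) * starRingEnd ℂ (e x)) * hFK +
      (2 * (om (‖F (t * e x)‖ ^ 2) : ℂ) * t * D (t * e x) * starRingEnd ℂ (D (t * e x))) * hee
      + m (‖F (t * e x)‖ ^ 2) * deriv K (t * e x) * e x * hI
  have hWint : ∀ t ∈ Set.Ioo (0 : ℝ) 1, ∫ x in -Real.pi..Real.pi, W t x = 0 := by
    intro t ht
    rw [intervalIntegral.integral_eq_sub_of_hasDerivAt (fun x _ => hWd t ht x)
      ((slice cW ⟨ht.1.le, ht.2⟩).intervalIntegrable _ _)]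
    have : e Real.pi = e (-Real.pi) := by
      simp only [e]; push_cast; rw [neg_mul, Complex.exp_neg, Complex.exp_pi_mul_I]; norm_num
    simp only [U, this, sub_self]
  have hJd : ∀ t ∈ Set.Ioo (0 : ℝ) 1,
      HasDerivAt (fun t => ∫ x in -Real.pi..Real.pi, U t x) (∫ x in -Real.pi..Real.pi, J t x) t := by
    intro t ht
    have ht' : t ∈ Set.Ico (0 : ℝ) 1 := ⟨ht.1.le, ht.2⟩
    refine (hasDerivAt_integral_of_continuousOn_deriv ht
      (fun s hs => slice cU ⟨hs.1.le, hs.2⟩)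
      (cV.mono (Set.prod_mono Set.Ioo_subset_Ico_self subset_rfl)) hVd).congr_deriv ?_
    have hw : IntervalIntegrable (fun x => Complex.I / t * W t x) volume (-Real.pi) Real.pi :=
      (continuous_const.mul (slice cW ht')).intervalIntegrable _ _
    simp only [key t ht]
    rw [intervalIntegral.integral_sub ((slice cJ ht').intervalIntegrable _ _) hw,
      intervalIntegral.integral_const_mul, hWint t ht, mul_zero, sub_zero]
  have hsub : Set.Icc 0 r ⊆ Set.Ico (0 : ℝ) 1 := fun t ht => ⟨ht.1, ht.2.trans_lt hr1⟩
  have h := intervalIntegral.integral_eq_sub_of_hasDerivAt_of_le hr0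
    ((continuousOn_integral_of_continuousOn cU).mono hsub)
    (fun t ht => hJd t ⟨ht.1, ht.2.trans hr1⟩)
    (((continuousOn_integral_of_continuousOn cJ).mono hsub).intervalIntegrable_of_Icc hr0)
  have h0 : ∫ x in -Real.pi..Real.pi, U 0 x = 0 := by simp [U, F, hm0]
  rw [h0, sub_zero] at h
  exact h

end

/-! ### Change of variables for weighted image areas. -/

section

theorem integral_ball_eq_polar {g : ℂ → ℝ} {r : ℝ} (hr : 0 ≤ r)
    (hg : ContinuousOn (fun p : ℝ × ℝ => g (p.1 * Complex.exp (p.2 * Complex.I)))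
      (Set.Icc 0 r ×ˢ Set.univ)) :
    ∫ z in ball (0 : ℂ) r, g z =
      ∫ t in (0 : ℝ)..r, ∫ x in -Real.pi..Real.pi, t * g (t * Complex.exp (x * Complex.I)) := by
  have hpi : -Real.pi ≤ Real.pi := by linarith [Real.pi_pos]
  let G : ℝ × ℝ → ℝ := fun p => p.1 * g (p.1 * Complex.exp (p.2 * Complex.I))
  have hG : ContinuousOn G (Set.Icc 0 r ×ˢ Set.Icc (-Real.pi) Real.pi) :=
    (continuousOn_fst.mul hg).mono (Set.prod_mono subset_rfl (Set.subset_univ _))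
  have hGi : IntegrableOn G (Set.Ioo 0 r ×ˢ Set.Ioo (-Real.pi) Real.pi) (volume.prod volume) :=
    (hG.integrableOn_compact (isCompact_Icc.prod isCompact_Icc)).mono_set
      (Set.prod_mono Set.Ioo_subset_Icc_self Set.Ioo_subset_Icc_self)
  rw [← integral_indicator measurableSet_ball, ← Complex.integral_comp_polarCoord_symm,
    ← integral_indicator (by exact polarCoord.open_target.measurableSet)]
  have h1 : (polarCoord.target.indicator fun p : ℝ × ℝ =>
      p.1 • (ball (0 : ℂ) r).indicator g (Complex.polarCoord.symm p)) =
      (Set.Ioo 0 r ×ˢ Set.Ioo (-Real.pi) Real.pi).indicator G := by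
    ext ⟨t, x⟩
    have hs : Complex.polarCoord.symm (t, x) = t * Complex.exp (x * Complex.I) := by
      rw [Complex.polarCoord_symm_apply, Complex.exp_mul_I]; simp
    have hn : ‖(t : ℂ) * Complex.exp (x * Complex.I)‖ = |t| := by
      rw [norm_mul, Complex.norm_exp_ofReal_mul_I]; simp
    by_cases ht : 0 < t
    · by_cases hx : x ∈ Set.Ioo (-Real.pi) Real.pi
      · have hball : (t : ℂ) * Complex.exp (x * Complex.I) ∈ ball (0 : ℂ) r ↔ t < r := by
          rw [mem_ball_zero_iff, hn, abs_of_pos ht]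
        rw [Set.indicator_of_mem (by exact ⟨ht, hx⟩)]
        simp only [hs]
        by_cases htr : t < r
        · rw [Set.indicator_of_mem (hball.2 htr), Set.indicator_of_mem (by exact ⟨⟨ht, htr⟩, hx⟩),
            smul_eq_mul]
        · rw [Set.indicator_of_notMem (mt hball.1 htr),
            Set.indicator_of_notMem (by intro h; exact htr h.1.2), smul_zero]
      · rw [Set.indicator_of_notMem (by intro h; exact hx h.2),
          Set.indicator_of_notMem (by intro h; exact hx h.2)]
    · rw [Set.indicator_of_notMem (by intro h; exact ht h.1),
        Set.indicator_of_notMem (by intro h; exact ht h.1.1)]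
  rw [h1, integral_indicator (measurableSet_Ioo.prod measurableSet_Ioo), Measure.volume_eq_prod,
    setIntegral_prod _ hGi, intervalIntegral.integral_of_le hr, integral_Ioc_eq_integral_Ioo]
  simp only [intervalIntegral.integral_of_le hpi, integral_Ioc_eq_integral_Ioo]
  rfl

theorem det_toSpanSingleton_restrictScalars (d : ℂ) :
    ((ContinuousLinearMap.toSpanSingleton ℂ d).restrictScalars ℝ).det = ‖d‖ ^ 2 := by
  simp [ContinuousLinearMap.det, LinearMap.det_restrictScalars,
    Algebra.norm_complex_eq, Complex.normSq_eq_norm_sq]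

variable {L : ℂ → ℂ} {om m : ℝ → ℝ}

theorem hasDerivAt_mul_exp (hL : AnalyticOnNhd ℂ L (ball 0 1)) {z : ℂ} (hz : z ∈ ball (0 : ℂ) 1) :
    HasDerivAt (fun z => z * Complex.exp (L z)) (Complex.exp (L z) * (1 + z * deriv L z)) z := by
  refine ((hasDerivAt_id z).mul (hL z hz).differentiableAt.hasDerivAt.cexp).congr_deriv ?_
  simp; ring

/-- Injectivity allows the change of variables with Jacobian |F'|²; Green's formula then moves the
integral to the circle. The 1/2 compensates for the density 2t there, against t in polar
coordinates. -/
theorem integral_image_weight (hL : AnalyticOnNhd ℂ L (ball 0 1))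
    (hinj : Set.InjOn (fun z => z * Complex.exp (L z)) (ball 0 1)) (hom : Continuous om)
    (hm : ∀ s, HasDerivAt m (om s) s) (hm0 : m 0 = 0) {r : ℝ} (hr0 : 0 ≤ r) (hr1 : r < 1) :
    ((∫ w in (fun z => z * Complex.exp (L z)) '' ball 0 r, om (‖w‖ ^ 2) : ℝ) : ℂ) =
    1 / 2 * ∫ x in -Real.pi..Real.pi, (m (‖(r * Complex.exp (x * Complex.I) : ℂ) *
        Complex.exp (L (r * Complex.exp (x * Complex.I)))‖ ^ 2) : ℂ) *
      (1 + r * Complex.exp (x * Complex.I) * deriv L (r * Complex.exp (x * Complex.I))) := by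
  have hsub : ball (0 : ℂ) r ⊆ ball 0 1 := ball_subset_ball hr1.le
  rw [← integral_weight_comp_eq_circle hL hom hm hm0 hr0 hr1,
    integral_image_eq_integral_abs_det_fderiv_smul volume measurableSet_ball
      (fun z hz => ((hasDerivAt_mul_exp hL (hsub hz)).hasFDerivAt.restrictScalars
        ℝ).hasFDerivWithinAt) (hinj.mono hsub)]
  simp only [det_toSpanSingleton_restrictScalars, smul_eq_mul, abs_pow, abs_norm]
  have hmaps : Set.MapsTo (fun p : ℝ × ℝ => (p.1 : ℂ) * Complex.exp (p.2 * Complex.I))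
      (Set.Icc 0 r ×ˢ Set.univ) (ball 0 1) := fun p hp => by
    rw [mem_ball_zero_iff, norm_mul, Complex.norm_exp_ofReal_mul_I]
    simpa [abs_of_nonneg hp.1.1] using hp.1.2.trans_lt hr1
  have hzc : ContinuousOn (fun p : ℝ × ℝ => (p.1 : ℂ) * Complex.exp (p.2 * Complex.I))
      (Set.Icc 0 r ×ˢ Set.univ) := by fun_prop
  have hLc : ContinuousOn L (ball 0 1) := hL.continuousOn
  have hL'c : ContinuousOn (deriv L) (ball 0 1) := hL.deriv.continuousOn
  have hc : ContinuousOn (fun z => ‖Complex.exp (L z) * (1 + z * deriv L z)‖ ^ 2 *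
      om (‖z * Complex.exp (L z)‖ ^ 2)) (ball 0 1) := by fun_prop
  rw [integral_ball_eq_polar hr0 (hc.comp hzc hmaps), intervalIntegral.integral_congr_ae
    (g := fun t => ∫ x in -Real.pi..Real.pi, 2⁻¹ * (2 * t *
      (om (‖(t * Complex.exp (x * Complex.I) : ℂ) *
        Complex.exp (L (t * Complex.exp (x * Complex.I)))‖ ^ 2) *
      ‖Complex.exp (L (t * Complex.exp (x * Complex.I))) * (1 + t * Complex.exp (x * Complex.I) *
        deriv L (t * Complex.exp (x * Complex.I)))‖ ^ 2)))]
  · simp only [intervalIntegral.integral_const_mul, intervalIntegral.integral_ofReal]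
    push_cast
    ring
  · refine Eventually.of_forall fun t _ => ?_
    refine intervalIntegral.integral_congr fun x _ => ?_
    ring

end

/-! ### The flattened power weight. -/

/-- A positive continuous weight which equals `s ^ (-(a + 1))` away from the origin, with its
primitive. -/
theorem exists_weight {a c : ℝ} (ha : 0 < a) (hc : 0 < c) :
    ∃ (om m : ℝ → ℝ) (M : ℝ), Continuous om ∧ (∀ s, 0 < om s) ∧ (∀ s, HasDerivAt m (om s) s) ∧
      m 0 = 0 ∧ ∀ s, c ≤ s → m s = M - s ^ (-a) / a := by
  -- Replacing s by max(s, c) removes the singularity at 0, where the pure power would not be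
  -- integrable. The constant `M` below is the integral of `om` over (0, ∞).
  let om : ℝ → ℝ := fun s => (max s c) ^ (-(a + 1))
  have hpos (s : ℝ) : 0 < max s c := lt_max_of_lt_right hc
  have hom : Continuous om :=
    (continuous_id.max continuous_const).rpow_const fun s => Or.inl (hpos s).ne'
  refine ⟨om, fun s => ∫ t in (0 : ℝ)..s, om t, (∫ t in (0 : ℝ)..c, om t) + c ^ (-a) / a, hom,
    fun s => Real.rpow_pos_of_pos (hpos s) _, fun s => (hom.integral_hasStrictDerivAt 0 s).hasDerivAt,
    by simp, fun s hs => ?_⟩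
  beta_reduce
  rw [← intervalIntegral.integral_add_adjacent_intervals (hom.intervalIntegrable 0 c)
    (hom.intervalIntegrable c s), intervalIntegral.integral_congr (a := c) (g := fun t => t ^ (-(a + 1)))]
  · rw [integral_rpow]
    · rw [show -(a + 1) + 1 = -a by ring]
      field_simp
      ring
    · right
      refine ⟨by linarith, ?_⟩
      rw [Set.uIcc_of_le hs]
      intro h; linarith [h.1]
  · intro t ht
    rw [Set.uIcc_of_le hs] at ht
    simp only [om, max_eq_left ht.1]

/-- Polar coordinates and s = y² reduce the planar integral to the limit of `m`. The finite total
mass lets the integral over an image be traded for the one over its complement. -/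
theorem integrable_weight_and_integral {om m : ℝ → ℝ} {M : ℝ} (hpos : ∀ s, 0 < om s)
    (hm : ∀ s, HasDerivAt m (om s) s) (hm0 : m 0 = 0) (hM : Tendsto m atTop (𝓝 M)) :
    Integrable (fun w : ℂ => om (‖w‖ ^ 2)) ∧ ∫ w : ℂ, om (‖w‖ ^ 2) = Real.pi * M := by
  have hd (y : ℝ) : HasDerivAt (fun y => m (y ^ 2) / 2) (y * om (y ^ 2)) y := by
    have := ((hm (y ^ 2)).comp y (hasDerivAt_pow 2 y)).div_const 2
    refine this.congr_deriv ?_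
    push_cast; ring
  have hlim : Tendsto (fun y : ℝ => m (y ^ 2) / 2) atTop (𝓝 (M / 2)) :=
    (hM.comp (tendsto_pow_atTop two_ne_zero)).div_const 2
  have hnn : ∀ y ∈ Set.Ioi (0 : ℝ), 0 ≤ y * om (y ^ 2) := fun y hy =>
    mul_nonneg (le_of_lt hy) (hpos _).le
  have hint := integrableOn_Ioi_deriv_of_nonneg' (fun y _ => hd y) hnn hlim
  have hval := integral_Ioi_of_hasDerivAt_of_nonneg' (fun y _ => hd y) hnn hlim
  constructor
  · rw [integrable_fun_norm_addHaar (volume : Measure ℂ) (f := fun y => om (y ^ 2))]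
    simpa [Complex.finrank_real_complex] using hint
  · rw [integral_fun_norm_addHaar (volume : Measure ℂ) (fun y => om (y ^ 2))]
    simp only [Complex.finrank_real_complex]
    simp only [Nat.add_one_sub_one, pow_one, smul_eq_mul, nsmul_eq_mul]
    rw [hval, measureReal_def, Complex.volume_ball]
    simp [hm0]
    ring

/-! ### Power series and Parseval's formula on circles. -/

theorem integral_circle_pow_mul_conj_pow (r : ℝ) (n k : ℕ) :
    ∫ x in -Real.pi..Real.pi, (r * Complex.exp (x * Complex.I)) ^ n *
      starRingEnd ℂ ((r * Complex.exp (x * Complex.I)) ^ k) =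
      if n = k then 2 * Real.pi * (r : ℂ) ^ (2 * n) else 0 := by
  have h (x : ℝ) : (r * Complex.exp (x * Complex.I)) ^ n *
      starRingEnd ℂ ((r * Complex.exp (x * Complex.I)) ^ k) =
      (r : ℂ) ^ (n + k) * Complex.exp (((n : ℂ) - k) * Complex.I * x) := by
    rw [map_pow, map_mul, Complex.conj_ofReal, ← Complex.exp_conj, mul_pow, mul_pow,
      ← Complex.exp_nat_mul, ← Complex.exp_nat_mul, map_mul, Complex.conj_ofReal, Complex.conj_I,
      mul_mul_mul_comm, ← pow_add, ← Complex.exp_add]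
    ring_nf
  simp only [h, intervalIntegral.integral_const_mul]
  split_ifs with hnk
  · subst hnk
    simp
    ring
  · have hc : ((n : ℂ) - k) * Complex.I ≠ 0 :=
      mul_ne_zero (sub_ne_zero.2 (by exact_mod_cast hnk)) Complex.I_ne_zero
    rw [integral_exp_mul_complex hc, sub_eq_zero.2, zero_div, mul_zero]
    rw [Complex.exp_eq_exp_iff_exists_int]
    refine ⟨(n : ℤ) - k, ?_⟩
    push_cast
    ring

/-- The Taylor coefficients at the origin. -/
noncomputable def taylorCoeff (g : ℂ → ℂ) (n : ℕ) : ℂ := iteratedDeriv n g 0 / n.factorial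

theorem hasSum_taylorCoeff {g : ℂ → ℂ} (hg : AnalyticOnNhd ℂ g (ball 0 1)) {z : ℂ}
    (hz : z ∈ ball (0 : ℂ) 1) : HasSum (fun n => taylorCoeff g n * z ^ n) (g z) := by
  have := Complex.hasSum_taylorSeries_on_ball hg.differentiableOn hz
  refine this.congr_fun fun n => ?_
  rw [taylorCoeff, sub_zero, smul_eq_mul, smul_eq_mul]; ring

theorem circle_mem_ball {r : ℝ} (hr0 : 0 ≤ r) (hr1 : r < 1) (x : ℝ) :
    (r : ℂ) * Complex.exp (x * Complex.I) ∈ ball (0 : ℂ) 1 := by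
  rw [mem_ball_zero_iff, norm_mul, Complex.norm_exp_ofReal_mul_I]
  simpa [abs_of_nonneg hr0] using hr1

theorem continuous_comp_circle {g : ℂ → ℂ} (hg : AnalyticOnNhd ℂ g (ball 0 1)) {r : ℝ}
    (hr0 : 0 ≤ r) (hr1 : r < 1) :
    Continuous fun x : ℝ => g (r * Complex.exp (x * Complex.I)) :=
  hg.continuousOn.comp_continuous (by fun_prop) fun x => circle_mem_ball hr0 hr1 x

theorem hasSum_integral_circle {g : ℂ → ℂ} (hg : AnalyticOnNhd ℂ g (ball 0 1)) {r : ℝ}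
    (hr0 : 0 ≤ r) (hr1 : r < 1) {G : ℝ → ℂ} (hG : Continuous G) :
    HasSum (fun n => taylorCoeff g n *
        ∫ x in -Real.pi..Real.pi, (r * Complex.exp (x * Complex.I)) ^ n * G x)
      (∫ x in -Real.pi..Real.pi, g (r * Complex.exp (x * Complex.I)) * G x) := by
  obtain ⟨C, hC⟩ := (isCompact_uIcc (a := -Real.pi) (b := Real.pi)).exists_bound_of_continuousOn
    hG.continuousOn
  have hsum : Summable fun n => ‖taylorCoeff g n‖ * r ^ n := by
    have hmem : (r : ℂ) ∈ ball (0 : ℂ) 1 := by simpa [abs_of_nonneg hr0] using hr1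
    have := (hasSum_taylorCoeff hg hmem).summable.norm
    simpa [abs_of_nonneg hr0] using this
  simp only [← intervalIntegral.integral_const_mul]
  refine intervalIntegral.hasSum_integral_of_dominated_convergence
    (fun n _ => ‖taylorCoeff g n‖ * r ^ n * C) (fun n => ?_) (fun n => ?_) ?_ ?_ ?_
  · exact Continuous.aestronglyMeasurable (by fun_prop)
  · refine Eventually.of_forall fun x hx => ?_
    rw [norm_mul, norm_mul, norm_pow, norm_mul, Complex.norm_exp_ofReal_mul_I, mul_one,
      Complex.norm_real, Real.norm_of_nonneg hr0, ← mul_assoc]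
    exact mul_le_mul_of_nonneg_left (hC x (Set.uIoc_subset_uIcc hx)) (by positivity)
  · exact Eventually.of_forall fun x _ => hsum.mul_right C
  · simp
  · refine Eventually.of_forall fun x _ => ?_
    have := (hasSum_taylorCoeff hg (circle_mem_ball hr0 hr1 x)).mul_right (G x)
    simpa only [mul_assoc] using this

theorem integral_circle_mul_conj_pow {g : ℂ → ℂ} (hg : AnalyticOnNhd ℂ g (ball 0 1)) {r : ℝ}
    (hr0 : 0 ≤ r) (hr1 : r < 1) (k : ℕ) :
    ∫ x in -Real.pi..Real.pi, g (r * Complex.exp (x * Complex.I)) *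
      starRingEnd ℂ ((r * Complex.exp (x * Complex.I)) ^ k) =
      2 * Real.pi * taylorCoeff g k * (r : ℂ) ^ (2 * k) := by
  have h := hasSum_integral_circle hg hr0 hr1
    (G := fun x => starRingEnd ℂ ((r * Complex.exp (x * Complex.I)) ^ k))
    (Complex.continuous_conj.comp (by fun_prop))
  simp only [integral_circle_pow_mul_conj_pow] at h
  refine h.unique ?_
  convert hasSum_single k ?_ using 1
  · simp; ring
  · intro n hn
    simp [hn]

/-- Parseval's formula on a circle. -/
theorem hasSum_integral_circle_mul_conj {g h : ℂ → ℂ} (hg : AnalyticOnNhd ℂ g (ball 0 1))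
    (hh : AnalyticOnNhd ℂ h (ball 0 1)) {r : ℝ} (hr0 : 0 ≤ r) (hr1 : r < 1) :
    HasSum (fun n => 2 * Real.pi * (taylorCoeff g n * starRingEnd ℂ (taylorCoeff h n)) *
        (r : ℂ) ^ (2 * n))
      (∫ x in -Real.pi..Real.pi, g (r * Complex.exp (x * Complex.I)) *
        starRingEnd ℂ (h (r * Complex.exp (x * Complex.I)))) := by
  have h1 := hasSum_integral_circle hg hr0 hr1
    (G := fun x => starRingEnd ℂ (h (r * Complex.exp (x * Complex.I))))
    (Complex.continuous_conj.comp (continuous_comp_circle hh hr0 hr1))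
  convert h1 using 2 with n
  have h2 := congrArg (starRingEnd ℂ) (integral_circle_mul_conj_pow hh hr0 hr1 n)
  rw [← intervalIntegral.intervalIntegral_conj] at h2
  simp only [map_mul, Complex.conj_conj] at h2
  simp only [mul_comm ((_ : ℂ) ^ n) (starRingEnd ℂ _)]
  rw [h2, Complex.conj_ofNat, Complex.conj_ofReal, map_pow, Complex.conj_ofReal]
  ring

/-! ### The area theorem. -/

section

/-- A Tauberian converse to Abel's theorem for eventually nonnegative series. -/
theorem hasSum_of_tendsto_of_nonneg {b : ℕ → ℝ} {N : ℕ} (hb : ∀ n, N ≤ n → 0 ≤ b n)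
    {ρ : ℕ → ℝ} (hρ0 : ∀ k, 0 ≤ ρ k) (hρ1 : ∀ k, ρ k ≤ 1) (hρ : Tendsto ρ atTop (𝓝 1))
    {S : ℕ → ℝ} {l : ℝ} (hS : ∀ k, HasSum (fun n => b n * ρ k ^ n) (S k))
    (hl : Tendsto S atTop (𝓝 l)) : HasSum b l := by
  have hterm (n : ℕ) : Tendsto (fun k => b n * ρ k ^ n) atTop (𝓝 (b n)) := by
    simpa using (hρ.pow n).const_mul (b n)
  -- For M ≥ N the omitted tail is nonnegative, so each partial sum at ρ_k is at most S_k; then k →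
  -- ∞.
  have hpart (M : ℕ) (hM : N ≤ M) : ∑ n ∈ range M, b n ≤ l := by
    refine le_of_tendsto_of_tendsto' (tendsto_finsetSum _ fun n _ => hterm n) hl fun k => ?_
    refine sum_le_hasSum _ (fun n hn => ?_) (hS k)
    have hn : M ≤ n := by simpa using hn
    exact mul_nonneg (hb n (hM.trans hn)) (pow_nonneg (hρ0 k) n)
  have hsum : Summable b := by
    rw [← summable_nat_add_iff N]
    refine summable_of_sum_range_le (c := l - ∑ n ∈ range N, b n)
      (fun n => hb _ (Nat.le_add_left _ _)) fun M => ?_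
    have h1 := hpart (N + M) (Nat.le_add_right _ _)
    rw [sum_range_add] at h1
    simp only [add_comm _ N]
    linarith
  have hlim : Tendsto (fun k => ∑' n, b n * ρ k ^ n) atTop (𝓝 (∑' n, b n)) := by
    refine tendsto_tsum_of_dominated_convergence hsum.abs hterm
      (Eventually.of_forall fun k n => ?_)
    rw [norm_mul, Real.norm_eq_abs, norm_pow, Real.norm_of_nonneg (hρ0 k)]
    exact mul_le_of_le_one_right (abs_nonneg _) (pow_le_one₀ (hρ0 k) (hρ1 k))
  simp only [fun k => (hS k).tsum_eq] at hlim
  rw [tendsto_nhds_unique hl hlim]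
  exact hsum.hasSum

theorem taylorCoeff_mul_deriv {H : ℂ → ℂ} (hH : AnalyticAt ℂ H 0) (n : ℕ) :
    taylorCoeff (fun z => z * deriv H z) n = n * taylorCoeff H n := by
  have h := iteratedDeriv_pow_mul hH.deriv n 1
  simp only [pow_one] at h
  rw [taylorCoeff, h]
  cases n with
  | zero => simp
  | succ n =>
    rw [if_pos (by omega), Nat.add_sub_cancel, ← iteratedDeriv_succ', taylorCoeff,
      Nat.factorial_succ]
    have : (n.factorial : ℂ) ≠ 0 := by exact_mod_cast n.factorial_ne_zero
    have : (n : ℂ) + 1 ≠ 0 := by exact_mod_cast n.succ_ne_zero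
    push_cast
    field_simp

theorem taylorCoeff_sub {g h : ℂ → ℂ} (hg : AnalyticAt ℂ g 0) (hh : AnalyticAt ℂ h 0) (n : ℕ) :
    taylorCoeff (fun z => g z - h z) n = taylorCoeff g n - taylorCoeff h n := by
  simp only [taylorCoeff]
  rw [iteratedDeriv_fun_sub hg.contDiffAt hh.contDiffAt, sub_div]

theorem taylorCoeff_const_mul (c : ℂ) (h : ℂ → ℂ) (n : ℕ) :
    taylorCoeff (fun z => c * h z) n = c * taylorCoeff h n := by
  simp only [taylorCoeff, iteratedDeriv_const_mul_field, mul_div_assoc]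

variable {L : ℂ → ℂ} {lam : ℝ}

/-- Parseval's formula for the boundary integral of the area theorem. -/
theorem hasSum_integral_circle_rpow (hlam : 0 < lam) (hL : AnalyticOnNhd ℂ L (ball 0 1)) {r : ℝ}
    (hr0 : 0 < r) (hr1 : r < 1) :
    HasSum (fun n : ℕ => ((2 * Real.pi * (1 - n / lam) *
        ‖taylorCoeff (fun z => Complex.exp (-lam * L z)) n‖ ^ 2 * (r ^ 2) ^ n : ℝ) : ℂ))
      ((r ^ (2 * lam) : ℝ) * ∫ x in -Real.pi..Real.pi,
        (((‖(r * Complex.exp (x * Complex.I) : ℂ) *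
          Complex.exp (L (r * Complex.exp (x * Complex.I)))‖ ^ 2) ^ (-lam) : ℝ) : ℂ) *
        (1 + r * Complex.exp (x * Complex.I) * deriv L (r * Complex.exp (x * Complex.I)))) := by
  set H : ℂ → ℂ := fun z => Complex.exp (-lam * L z) with hHdef
  have hH : AnalyticOnNhd ℂ H (ball 0 1) := fun z hz =>
    (analyticAt_const.fun_mul (hL z hz)).cexp
  have hH' : ∀ z ∈ ball (0 : ℂ) 1, deriv H z = H z * (-lam * deriv L z) := fun z hz =>
    ((hL z hz).differentiableAt.hasDerivAt.const_mul (-(lam : ℂ))).cexp.deriv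
  have hzH : AnalyticOnNhd ℂ (fun z => z * deriv H z) (ball 0 1) := fun z hz =>
    analyticAt_id.fun_mul (hH.deriv z hz)
  have h0 : (0 : ℂ) ∈ ball (0 : ℂ) 1 := by simp
  -- Since H' = -λL'H, this function is H(1 + zL'). Its coefficients are (1 - n/λ)a_n, so pairing it
  -- with `H` in Parseval gives the stated series.
  have hQ : AnalyticOnNhd ℂ (fun z => H z - (lam : ℂ)⁻¹ * (z * deriv H z)) (ball 0 1) :=
    fun z hz => (hH z hz).fun_sub (analyticAt_const.fun_mul (hzH z hz))
  have hP := hasSum_integral_circle_mul_conj hQ hH hr0.le hr1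
  rw [← intervalIntegral.integral_const_mul]
  convert hP using 1
  · ext n
    rw [taylorCoeff_sub (hH 0 h0) (analyticAt_const.fun_mul (hzH 0 h0)), taylorCoeff_const_mul,
      taylorCoeff_mul_deriv (hH 0 h0)]
    have hn : ((‖taylorCoeff H n‖ : ℝ) : ℂ) ^ 2 =
        taylorCoeff H n * starRingEnd ℂ (taylorCoeff H n) := by
      rw [Complex.mul_conj, Complex.normSq_eq_norm_sq]; push_cast; rfl
    push_cast
    rw [hn, pow_mul]
    ring
  · refine intervalIntegral.integral_congr fun x _ => ?_
    have hz := circle_mem_ball hr0.le hr1 x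
    set z : ℂ := r * Complex.exp (x * Complex.I) with hzdef
    have hzn : ‖z‖ = r := by
      rw [hzdef, norm_mul, Complex.norm_exp_ofReal_mul_I]; simp [abs_of_pos hr0]
    -- The factor r^(2λ) cancels the |z|^(-2λ) contained in |F|^(-2λ).
    have hnorm : r ^ (2 * lam) * (‖z * Complex.exp (L z)‖ ^ 2) ^ (-lam) = ‖H z‖ ^ 2 := by
      rw [norm_mul, hzn, hHdef, Complex.norm_exp, Complex.norm_exp, ← Real.rpow_natCast_mul
        (by positivity), Real.mul_rpow hr0.le (Real.exp_pos _).le, ← Real.exp_mul, ← mul_assoc,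
        ← Real.rpow_add hr0, ← Real.exp_nat_mul]
      rw [show 2 * lam + (2 : ℕ) * -lam = 0 by push_cast; ring, Real.rpow_zero, one_mul]
      congr 1
      simp
      ring
    rw [hH' z hz, ← mul_assoc, ← Complex.ofReal_mul, hnorm]
    have hl : (lam : ℂ) ≠ 0 := by exact_mod_cast hlam.ne'
    have hn : ((‖H z‖ ^ 2 : ℝ) : ℂ) = H z * starRingEnd ℂ (H z) := by
      rw [Complex.mul_conj, Complex.normSq_eq_norm_sq]
    rw [hn]
    field_simp
    ring

theorem integral_circle_one_add_mul_deriv (hL : AnalyticOnNhd ℂ L (ball 0 1)) {r : ℝ}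
    (hr0 : 0 ≤ r) (hr1 : r < 1) :
    ∫ x in -Real.pi..Real.pi,
      (1 + r * Complex.exp (x * Complex.I) * deriv L (r * Complex.exp (x * Complex.I)))
      = 2 * Real.pi := by
  have hK : AnalyticOnNhd ℂ (fun z => 1 + z * deriv L z) (ball 0 1) := fun z hz =>
    analyticAt_const.fun_add (analyticAt_id.fun_mul (hL.deriv z hz))
  simpa [taylorCoeff] using integral_circle_mul_conj_pow hK hr0 hr1 0

/-- The area theorem on a subdisk. -/
theorem hasSum_area_subdisk (hlam : 0 < lam) (hL : AnalyticOnNhd ℂ L (ball 0 1))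
    (hinj : Set.InjOn (fun z => z * Complex.exp (L z)) (ball 0 1)) {om m : ℝ → ℝ} {M c : ℝ}
    (hom : Continuous om) (hm : ∀ s, HasDerivAt m (om s) s) (hm0 : m 0 = 0)
    (hmM : ∀ s, c ≤ s → m s = M - s ^ (-lam) / lam) {r : ℝ} (hr0 : 0 < r) (hr1 : r < 1)
    (hc : ∀ z : ℂ, ‖z‖ = r → c ≤ ‖z * Complex.exp (L z)‖ ^ 2) :
    HasSum (fun n : ℕ => ((n - lam) *
        ‖taylorCoeff (fun z => Complex.exp (-lam * L z)) n‖ ^ 2) * (r ^ 2) ^ n)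
      (lam ^ 2 / Real.pi * r ^ (2 * lam) *
        ((∫ w in (fun z => z * Complex.exp (L z)) '' ball 0 r, om (‖w‖ ^ 2)) - Real.pi * M)) := by
  have h1 := integral_image_weight hL hinj hom hm hm0 hr0.le hr1
  have h2 := hasSum_integral_circle_rpow hlam hL hr0 hr1
  set I : ℂ := ∫ x in -Real.pi..Real.pi, (((‖(r * Complex.exp (x * Complex.I) : ℂ) *
          Complex.exp (L (r * Complex.exp (x * Complex.I)))‖ ^ 2) ^ (-lam) : ℝ) : ℂ) *
        (1 + r * Complex.exp (x * Complex.I) * deriv L (r * Complex.exp (x * Complex.I)))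
    with hI
  set A : ℝ := ∫ w in (fun z => z * Complex.exp (L z)) '' ball 0 r, om (‖w‖ ^ 2) with hA
  have hl : (lam : ℂ) ≠ 0 := by exact_mod_cast hlam.ne'
  have hpi : (Real.pi : ℂ) ≠ 0 := by exact_mod_cast Real.pi_ne_zero
  have hK : AnalyticOnNhd ℂ (fun z => 1 + z * deriv L z) (ball 0 1) := fun z hz =>
    analyticAt_const.fun_add (analyticAt_id.fun_mul (hL.deriv z hz))
  have hKc := continuous_comp_circle hK hr0.le hr1
  have hFa : AnalyticOnNhd ℂ (fun z => z * Complex.exp (L z)) (ball 0 1) := fun z hz =>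
    analyticAt_id.fun_mul (hL z hz).cexp
  have hFc := continuous_comp_circle hFa hr0.le hr1
  have hcirc (x : ℝ) : ‖(r : ℂ) * Complex.exp (x * Complex.I)‖ = r := by
    rw [norm_mul, Complex.norm_exp_ofReal_mul_I]; simp [abs_of_pos hr0]
  have hF0 (x : ℝ) : ‖(r * Complex.exp (x * Complex.I) : ℂ) *
          Complex.exp (L (r * Complex.exp (x * Complex.I)))‖ ^ 2 ≠ 0 := by
    rw [norm_mul, hcirc]
    have := Complex.exp_ne_zero (L (r * Complex.exp (x * Complex.I)))
    positivity
  -- On the circle m(s) = M - s^(-λ)/λ. The constant contributes πM by the mean value property, the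
  -- power gives the Parseval integral.
  have h3 : (A : ℂ) = Real.pi * M - 1 / (2 * lam) * I := by
    rw [h1]
    have hexp : ∀ x : ℝ, (m (‖(r * Complex.exp (x * Complex.I) : ℂ) *
        Complex.exp (L (r * Complex.exp (x * Complex.I)))‖ ^ 2) : ℂ) *
      (1 + r * Complex.exp (x * Complex.I) * deriv L (r * Complex.exp (x * Complex.I))) =
      (M : ℂ) * (1 + r * Complex.exp (x * Complex.I) * deriv L (r * Complex.exp (x * Complex.I))) -
      (lam : ℂ)⁻¹ * ((((‖(r * Complex.exp (x * Complex.I) : ℂ) *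
          Complex.exp (L (r * Complex.exp (x * Complex.I)))‖ ^ 2) ^ (-lam) : ℝ) : ℂ) *
        (1 + r * Complex.exp (x * Complex.I) * deriv L (r * Complex.exp (x * Complex.I)))) := by
      intro x
      rw [hmM _ (hc _ (hcirc x))]
      push_cast
      ring
    have hi1 : IntervalIntegrable (fun x : ℝ => (M : ℂ) * (1 + r * Complex.exp (x * Complex.I) *
        deriv L (r * Complex.exp (x * Complex.I)))) volume (-Real.pi) Real.pi :=
      (continuous_const.mul hKc).intervalIntegrable _ _
    have hi2 : IntervalIntegrable (fun x : ℝ =>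
        (lam : ℂ)⁻¹ * ((((‖(r * Complex.exp (x * Complex.I) : ℂ) *
          Complex.exp (L (r * Complex.exp (x * Complex.I)))‖ ^ 2) ^ (-lam) : ℝ) : ℂ) *
        (1 + r * Complex.exp (x * Complex.I) * deriv L (r * Complex.exp (x * Complex.I)))))
        volume (-Real.pi) Real.pi :=
      (continuous_const.mul ((Complex.continuous_ofReal.comp ((hFc.norm.pow 2).rpow_const
        fun x => Or.inl (hF0 x))).mul hKc)).intervalIntegrable _ _
    simp only [hexp]
    rw [intervalIntegral.integral_sub hi1 hi2, intervalIntegral.integral_const_mul,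
      intervalIntegral.integral_const_mul, integral_circle_one_add_mul_deriv hL hr0.le hr1, ← hI]
    field_simp
  -- This factor turns 2π(1 - n/λ) into n - λ.
  have h4 := h2.mul_left (-(lam : ℂ) / (2 * Real.pi))
  refine Complex.hasSum_ofReal.1 ?_
  have h5 : ((lam ^ 2 / Real.pi * r ^ (2 * lam) * (A - Real.pi * M) : ℝ) : ℂ) =
      -(lam : ℂ) / (2 * Real.pi) * ((r ^ (2 * lam) : ℝ) * I) := by
    push_cast
    rw [h3]
    field_simp
    ring
  rw [h5]
  refine h4.congr_fun fun n => ?_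
  push_cast
  field_simp
  ring

/-- The generalized area theorem: the defect in Prawitz's inequality is a weighted area of the
complement of the image. -/
theorem exists_hasSum_area (hlam : 0 < lam) (hL : AnalyticOnNhd ℂ L (ball 0 1))
    (hinj : Set.InjOn (fun z => z * Complex.exp (L z)) (ball 0 1)) :
    ∃ I : ℝ, (I = 0 ↔ volume ((fun z => z * Complex.exp (L z)) '' ball 0 1)ᶜ = 0) ∧
      HasSum (fun n : ℕ => (n - lam) *
        ‖taylorCoeff (fun z => Complex.exp (-lam * L z)) n‖ ^ 2) (-I) := by
  set F : ℂ → ℂ := fun z => z * Complex.exp (L z) with hF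
  have hFd : ∀ z ∈ ball (0 : ℂ) 1, AnalyticAt ℂ F z := fun z hz =>
    analyticAt_id.fun_mul (hL z hz).cexp
  -- F'(0) ≠ 0 makes `F` open at 0. By injectivity circles of radius at least 1/2 then map outside
  -- the δ-ball, so flattening the weight below c = δ² does not affect it on their images.
  obtain ⟨δ, hδ, hδF⟩ : ∃ δ > 0, ball (0 : ℂ) δ ⊆ F '' ball 0 (1 / 2) := by
    have h0 : (0 : ℂ) ∈ ball (0 : ℂ) 1 := by simp
    have hd : HasStrictDerivAt F (deriv F 0) 0 := (hFd 0 h0).hasStrictDerivAt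
    have hne : deriv F 0 ≠ 0 := by
      rw [(hasDerivAt_mul_exp hL h0).deriv]
      simp
    have := hd.map_nhds_eq hne
    have h1 : F '' ball 0 (1 / 2) ∈ 𝓝 (F 0) := by
      rw [← this]; exact image_mem_map (ball_mem_nhds _ (by norm_num))
    simpa [F] using Metric.mem_nhds_iff.1 h1
  have hlow : ∀ r : ℝ, 1 / 2 ≤ r → r < 1 → ∀ z : ℂ, ‖z‖ = r → δ ^ 2 ≤ ‖F z‖ ^ 2 := by
    intro r hr hr1 z hz
    refine pow_le_pow_left₀ hδ.le ?_ 2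
    by_contra! hlt
    obtain ⟨z', hz', hzz⟩ := hδF (mem_ball_zero_iff.2 hlt)
    have : z' = z := hinj (ball_subset_ball (by norm_num) hz') (by simpa [hz] using hr1) hzz
    rw [this, mem_ball_zero_iff, hz] at hz'
    linarith
  obtain ⟨om, m, M, hom, hpos, hm, hm0, hmM⟩ := exists_weight hlam (by positivity : 0 < δ ^ 2)
  have hlimM : Tendsto m atTop (𝓝 M) := by
    have h1 : Tendsto (fun s : ℝ => M - s ^ (-lam) / lam) atTop (𝓝 (M - 0 / lam)) :=
      tendsto_const_nhds.sub ((tendsto_rpow_neg_atTop hlam).div_const lam)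
    rw [zero_div, sub_zero] at h1
    exact h1.congr' ((eventually_ge_atTop (δ ^ 2)).mono fun s hs => (hmM s hs).symm)
  obtain ⟨hint, htot⟩ := integrable_weight_and_integral hpos hm hm0 hlimM
  have hmeas : ∀ s ⊆ ball (0 : ℂ) 1, MeasurableSet s → MeasurableSet (F '' s) := fun s hs hms =>
    measurable_image_of_fderivWithin hms (fun z hz =>
      ((hFd z (hs hz)).differentiableAt.hasDerivAt.hasFDerivAt.restrictScalars
        ℝ).hasFDerivWithinAt) (hinj.mono hs)
  have hmeasF := hmeas _ subset_rfl measurableSet_ball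
  refine ⟨lam ^ 2 / Real.pi * ∫ w in (F '' ball 0 1)ᶜ, om (‖w‖ ^ 2), ?_, ?_⟩
  · have hp : lam ^ 2 / Real.pi ≠ 0 := by have := Real.pi_pos; positivity
    rw [mul_eq_zero, or_iff_right hp]
    have h1 := setIntegral_pos_iff_support_of_nonneg_ae (s := (F '' ball 0 1)ᶜ) (μ := volume)
      (f := fun w : ℂ => om (‖w‖ ^ 2)) (Eventually.of_forall fun w => (hpos _).le)
      hint.integrableOn
    have h2 : Function.support (fun w : ℂ => om (‖w‖ ^ 2)) = Set.univ := by
      ext w; simp [(hpos _).ne']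
    rw [h2, Set.univ_inter] at h1
    have h3 : 0 ≤ ∫ w in (F '' ball 0 1)ᶜ, om (‖w‖ ^ 2) :=
      integral_nonneg fun w => (hpos _).le
    constructor
    · intro h
      by_contra hne
      exact (h1.2 (pos_iff_ne_zero.2 hne)).ne' h
    · intro h
      by_contra hne
      exact (h1.1 (lt_of_le_of_ne h3 (Ne.symm hne))).ne' h
  · have hcompl : (∫ w in F '' ball 0 1, om (‖w‖ ^ 2)) - Real.pi * M =
        -∫ w in (F '' ball 0 1)ᶜ, om (‖w‖ ^ 2) := by
      rw [← htot, ← integral_add_compl hmeasF hint]; ring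
    -- Radii increasing to 1 and starting at 1/2, so that the lower bound `hlow` applies to all of
    -- them.
    let ρ : ℕ → ℝ := fun k => 1 - 1 / ((k : ℝ) + 2)
    have hρh (k : ℕ) : 1 / 2 ≤ ρ k := by
      have : 1 / ((k : ℝ) + 2) ≤ 1 / 2 := one_div_le_one_div_of_le (by norm_num) (by simp)
      simp only [ρ]; linarith
    have hρ1 (k : ℕ) : ρ k < 1 := by
      have : 0 < 1 / ((k : ℝ) + 2) := by positivity
      simp only [ρ]; linarith
    have hρ0 (k : ℕ) : 0 < ρ k := by linarith [hρh k]
    have hρmono : Monotone ρ := by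
      intro k l hkl
      have : 1 / ((l : ℝ) + 2) ≤ 1 / ((k : ℝ) + 2) :=
        one_div_le_one_div_of_le (by positivity) (by gcongr)
      simp only [ρ]; linarith
    have hρlim : Tendsto ρ atTop (𝓝 1) := by
      have h1 : Tendsto (fun k : ℕ => 1 / ((k : ℝ) + 2)) atTop (𝓝 0) := by
        simp only [one_div]
        exact tendsto_inv_atTop_zero.comp
          (tendsto_atTop_add_const_right _ _ tendsto_natCast_atTop_atTop)
      simpa only [sub_zero] using h1.const_sub 1
    have hunion : ⋃ k, F '' ball 0 (ρ k) = F '' ball 0 1 := by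
      rw [← Set.image_iUnion]
      congr 1
      ext z
      simp only [Set.mem_iUnion, mem_ball_zero_iff]
      exact ⟨fun ⟨k, hk⟩ => hk.trans (hρ1 k), fun hz => (hρlim.eventually_const_lt hz).exists⟩
    have hint2 : Tendsto (fun k => ∫ w in F '' ball 0 (ρ k), om (‖w‖ ^ 2)) atTop
        (𝓝 (∫ w in F '' ball 0 1, om (‖w‖ ^ 2))) := by
      rw [← hunion]
      exact tendsto_setIntegral_of_monotone
        (fun k => hmeas _ (ball_subset_ball (hρ1 k).le) measurableSet_ball)
        (fun k l hkl => Set.image_mono (ball_subset_ball (hρmono hkl))) hint.integrableOn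
    obtain ⟨N, hN⟩ := exists_nat_ge lam
    refine hasSum_of_tendsto_of_nonneg (N := N) (ρ := fun k => ρ k ^ 2) (fun n hn => ?_)
      (fun k => sq_nonneg _) (fun k => pow_le_one₀ (hρ0 k).le (hρ1 k).le)
      (by simpa using hρlim.pow 2)
      (fun k => hasSum_area_subdisk hlam hL hinj hom hm hm0 hmM (hρ0 k) (hρ1 k)
        (hlow _ (hρh k) (hρ1 k))) ?_
    · have : (N : ℝ) ≤ n := by exact_mod_cast hn
      exact mul_nonneg (by linarith) (sq_nonneg _)
    · have h1 : Tendsto (fun k => ρ k ^ (2 * lam)) atTop (𝓝 1) := by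
        have := hρlim.rpow_const (p := 2 * lam) (Or.inl one_ne_zero)
        simpa using this
      have h2 := (h1.const_mul (lam ^ 2 / Real.pi)).mul (hint2.sub_const (Real.pi * M))
      rw [hcompl] at h2
      simpa using h2

end

/-! ### Disk automorphisms and the Koebe transform. -/

section

/-- The disk automorphism sending `0` to `ζ`. -/
noncomputable def mobius (ζ z : ℂ) : ℂ := (z + ζ) / (1 + starRingEnd ℂ ζ * z)

theorem norm_sq_sub_norm_sq (ζ z : ℂ) :
    ‖1 + starRingEnd ℂ ζ * z‖ ^ 2 - ‖z + ζ‖ ^ 2 = (1 - ‖z‖ ^ 2) * (1 - ‖ζ‖ ^ 2) := by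
  simp only [← Complex.normSq_eq_norm_sq, Complex.normSq_apply]
  simp
  ring

section

variable {ζ z : ℂ} (hζ : ‖ζ‖ < 1) (hz : ‖z‖ < 1)

include hζ hz

theorem norm_add_lt : ‖z + ζ‖ < ‖1 + starRingEnd ℂ ζ * z‖ := by
  refine lt_of_pow_lt_pow_left₀ 2 (norm_nonneg _) (sub_pos.1 ?_)
  rw [norm_sq_sub_norm_sq]
  have h1 : ‖z‖ ^ 2 < 1 := pow_lt_one₀ (norm_nonneg _) hz two_ne_zero
  have h2 : ‖ζ‖ ^ 2 < 1 := pow_lt_one₀ (norm_nonneg _) hζ two_ne_zero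
  exact mul_pos (by linarith) (by linarith)

theorem one_add_conj_mul_ne_zero : 1 + starRingEnd ℂ ζ * z ≠ 0 :=
  norm_pos_iff.1 ((norm_nonneg _).trans_lt (norm_add_lt hζ hz))

theorem norm_mobius_lt_one : ‖mobius ζ z‖ < 1 := by
  rw [mobius, norm_div, div_lt_one ((norm_nonneg _).trans_lt (norm_add_lt hζ hz))]
  exact norm_add_lt hζ hz

theorem mobius_eq_add : mobius ζ z =
    ζ + (1 - (‖ζ‖ : ℂ) ^ 2) * z / (1 + starRingEnd ℂ ζ * z) := by
  have h := one_add_conj_mul_ne_zero hζ hz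
  have h2 : (‖ζ‖ : ℂ) ^ 2 = ζ * starRingEnd ℂ ζ := by
    rw [Complex.mul_conj, Complex.normSq_eq_norm_sq]; push_cast; rfl
  rw [mobius, h2, div_eq_iff h, add_mul, div_mul_cancel₀ _ h]
  ring

theorem mobius_neg_mobius : mobius ζ (mobius (-ζ) z) = z := by
  have h := one_add_conj_mul_ne_zero (ζ := -ζ) (by simpa) hz
  have h' := one_add_conj_mul_ne_zero hζ (norm_mobius_lt_one (ζ := -ζ) (by simpa) hz)
  have e : mobius (-ζ) z * (1 + starRingEnd ℂ (-ζ) * z) = z + -ζ := by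
    rw [mobius, div_mul_cancel₀ _ h]
  rw [map_neg] at e
  rw [mobius, div_eq_iff h']
  linear_combination e

theorem analyticAt_mobius : AnalyticAt ℂ (mobius ζ) z :=
  AnalyticAt.fun_div (by fun_prop) (by fun_prop) (one_add_conj_mul_ne_zero hζ hz)

end

theorem one_sub_norm_sq_ne_zero {ζ : ℂ} (hζ : ‖ζ‖ < 1) : 1 - (‖ζ‖ : ℂ) ^ 2 ≠ 0 := by
  have h2 : ‖ζ‖ ^ 2 < 1 := pow_lt_one₀ (norm_nonneg _) hζ two_ne_zero
  have : (1 - ‖ζ‖ ^ 2 : ℝ) ≠ 0 := by linarith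
  exact_mod_cast this

/-- The quotient `F z / z` for the Koebe transform `F` of `f` at `ζ`. -/
noncomputable def koebeQuotient (f : ℂ → ℂ) (ζ z : ℂ) : ℂ :=
  dslope f ζ (mobius ζ z) / (deriv f ζ * (1 + starRingEnd ℂ ζ * z))

variable {f : ℂ → ℂ} {ζ z : ℂ}

theorem koebeQuotient_zero (h : deriv f ζ ≠ 0) : koebeQuotient f ζ 0 = 1 := by
  simp [koebeQuotient, mobius, h]

theorem analyticOnNhd_koebeQuotient (hf : AnalyticOnNhd ℂ f disk) (hζ : ‖ζ‖ < 1)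
    (h : deriv f ζ ≠ 0) : AnalyticOnNhd ℂ (koebeQuotient f ζ) (ball 0 1) := by
  have hd : AnalyticOnNhd ℂ (dslope f ζ) disk := by
    refine DifferentiableOn.analyticOnNhd ?_ isOpen_ball
    exact (Complex.differentiableOn_dslope
      (isOpen_ball.mem_nhds (by simpa [disk] using hζ))).2 hf.differentiableOn
  intro z hz
  have hz : ‖z‖ < 1 := by simpa using hz
  have hm : mobius ζ z ∈ disk := by simpa [disk] using norm_mobius_lt_one hζ hz
  exact ((hd _ hm).comp (analyticAt_mobius hζ hz)).fun_div (by fun_prop)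
    (mul_ne_zero h (one_add_conj_mul_ne_zero hζ hz))

theorem mul_koebeQuotient (hζ : ‖ζ‖ < 1) (hz : ‖z‖ < 1) (h : deriv f ζ ≠ 0) :
    z * koebeQuotient f ζ z =
      (f (mobius ζ z) - f ζ) / ((1 - (‖ζ‖ : ℂ) ^ 2) * deriv f ζ) := by
  have h1 := one_add_conj_mul_ne_zero hζ hz
  have h2 := one_sub_norm_sq_ne_zero hζ
  have h3 := sub_smul_dslope f ζ (mobius ζ z)
  rw [← h3, koebeQuotient, smul_eq_mul]
  nth_rewrite 2 [mobius_eq_add hζ hz]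
  field_simp
  ring

/-- Near 0 the sum of the principal logarithms of 1 + ζ̄z and of the kernel equals -L: both are
continuous, vanish at 0 and have the same exponential. Only the germ of `L` matters, so a logarithm
on the whole disk and a merely local one both serve. -/
theorem prawitzCoeff_eq_taylorCoeff (lam : ℝ) (hf : AnalyticOnNhd ℂ f disk) (hζ : ‖ζ‖ < 1)
    (h : deriv f ζ ≠ 0) {L : ℂ → ℂ} (hL : ContinuousAt L 0) (hL0 : L 0 = 0)
    (hexp : ∀ᶠ z in 𝓝 0, Complex.exp (L z) = koebeQuotient f ζ z) (n : ℕ) :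
    prawitzCoeff lam f ζ n = taylorCoeff (fun z => Complex.exp (-lam * L z)) n := by
  have hfζ : AnalyticAt ℂ f ζ := hf ζ (by simpa [disk] using hζ)
  rw [prawitzCoeff_eq_iteratedDeriv lam hfζ h n, taylorCoeff]
  congr 1
  refine EventuallyEq.iteratedDeriv_eq n ?_
  set u : ℂ → ℂ := fun z => 1 + starRingEnd ℂ ζ * z with hu
  set k : ℂ → ℂ := fun z => kernel f ζ (ζ + (1 - (‖ζ‖ : ℂ) ^ 2) * z / u z) with hk
  have huc : ContinuousAt u 0 := by fun_prop
  have hu0 : u 0 = 1 := by simp [u]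
  have hk0 : k 0 = 1 := by simp [k, kernel]
  have hkc : ContinuousAt k 0 := by
    have hdc : ContinuousAt (dslope f ζ) ζ := continuousAt_dslope_same.2 hfζ.differentiableAt
    have hin : ContinuousAt (fun z => ζ + (1 - (‖ζ‖ : ℂ) ^ 2) * z / u z) 0 := by
      refine continuousAt_const.add (ContinuousAt.div (by fun_prop) huc (by simp [hu0]))
    simp only [hk, kernel_eq_div_dslope h]
    refine ContinuousAt.div continuousAt_const
      (ContinuousAt.comp_of_eq hdc hin (by simp)) (by simp [h])
  have hlogc : ContinuousAt (fun z => Complex.log (u z) + Complex.log (k z)) 0 :=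
    (huc.clog (by simp [hu0])).add (hkc.clog (by simp [hk0]))
  -- Close to 0 the imaginary part stays in (-π, π), where the principal logarithm inverts the
  -- exponential.
  have small {g : ℂ → ℂ} (hg : ContinuousAt g 0) (hg0 : g 0 = 0) :
      ∀ᶠ z in 𝓝 0, Complex.log (Complex.exp (g z)) = g z := by
    have him : ContinuousAt (fun z => (g z).im) 0 := Complex.continuous_im.continuousAt.comp hg
    have h1 := him.eventually_mem (Ioo_mem_nhds (a := -Real.pi) (b := Real.pi)
      (by simp [hg0, Real.pi_pos]) (by simp [hg0, Real.pi_pos]))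
    filter_upwards [h1] with z hz
    exact Complex.log_exp hz.1 hz.2.le
  have hball : ∀ᶠ z : ℂ in 𝓝 0, ‖z‖ < 1 := by
    have := ball_mem_nhds (0 : ℂ) one_pos
    filter_upwards [this] with z hz using by simpa using hz
  filter_upwards [huc.eventually_ne (by simp [hu0] : u 0 ≠ 0),
    hkc.eventually_ne (by simp [hk0] : k 0 ≠ 0), small hlogc (by simp [hu0, hk0]),
    small hL.neg (by simp [hL0]), hexp, hball] with z hz1 hz2 hz3 hz4 hz5 hz6
  have hkey : Complex.log (u z) + Complex.log (k z) = -L z := by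
    rw [← hz3]
    refine Eq.trans ?_ hz4
    congr 1
    rw [Complex.exp_add, Complex.exp_log hz1, Complex.exp_log hz2, Pi.neg_apply, Complex.exp_neg,
      hz5, koebeQuotient, mobius_eq_add hζ hz6]
    simp only [hk, kernel_eq_div_dslope h, hu]
    rw [inv_div]
    ring
  change u z ^ (lam : ℂ) * k z ^ (lam : ℂ) = _
  rw [Complex.cpow_def_of_ne_zero hz1, Complex.cpow_def_of_ne_zero hz2, ← Complex.exp_add,
    ← add_mul, hkey]
  ring_nf

/-! ### Logarithms and absence of zeros. -/

/-- A nonvanishing function on the disk normalized at the origin has a holomorphic logarithm. -/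
theorem exists_log_of_ne_zero {p : ℂ → ℂ} (hp : AnalyticOnNhd ℂ p (ball 0 1)) (hp0 : p 0 = 1)
    (hne : ∀ z ∈ ball (0 : ℂ) 1, p z ≠ 0) :
    ∃ L : ℂ → ℂ, AnalyticOnNhd ℂ L (ball 0 1) ∧ L 0 = 0 ∧
      ∀ z ∈ ball (0 : ℂ) 1, Complex.exp (L z) = p z := by
  have hd : DifferentiableOn ℂ (fun z => deriv p z / p z) (ball 0 1) :=
    hp.deriv.differentiableOn.div hp.differentiableOn hne
  obtain ⟨L₀, hL₀⟩ := hd.isExactOn_ball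
  let L : ℂ → ℂ := fun z => L₀ z - L₀ 0
  have hL : ∀ z ∈ ball (0 : ℂ) 1, HasDerivAt L (deriv p z / p z) z := fun z hz =>
    (hL₀ z hz).sub_const _
  have hLd : DifferentiableOn ℂ L (ball 0 1) := fun z hz =>
    (hL z hz).differentiableAt.differentiableWithinAt
  have hq : ∀ z ∈ ball (0 : ℂ) 1, HasDerivAt (fun z => p z * Complex.exp (-L z)) 0 z := by
    intro z hz
    refine ((hp z hz).differentiableAt.hasDerivAt.mul (hL z hz).neg.cexp).congr_deriv ?_
    have := hne z hz
    simp only [Pi.neg_apply]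
    field_simp
    ring
  refine ⟨L, hLd.analyticOnNhd isOpen_ball, by simp [L], fun z hz => ?_⟩
  have hc := isOpen_ball.is_const_of_deriv_eq_zero (convex_ball (0 : ℂ) 1).isPreconnected
    (fun w hw => (hq w hw).differentiableAt.differentiableWithinAt) (fun w hw => (hq w hw).deriv)
    hz (mem_ball_self one_pos : (0 : ℂ) ∈ ball (0 : ℂ) 1)
  have h0 : L 0 = 0 := by simp [L]
  simp only [h0, hp0, neg_zero, Complex.exp_zero, mul_one, Complex.exp_neg] at hc
  field_simp at hc
  exact hc.symm

/-- A holomorphic solution of `lam p' H + p H' = 0` prevents zeros of `p`. -/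
theorem ne_zero_of_mul_deriv_add_eq_zero {lam : ℝ} (hlam : 0 < lam) {p H : ℂ → ℂ} {U : Set ℂ}
    (hUo : IsOpen U) (hU : IsPreconnected U)
    (hp : AnalyticOnNhd ℂ p U) (hH : AnalyticOnNhd ℂ H U) {z₀ : ℂ} (h0 : z₀ ∈ U)
    (hp0 : p z₀ ≠ 0) (hH0 : H z₀ ≠ 0)
    (hode : ∀ z ∈ U, lam * deriv p z * H z + p z * deriv H z = 0) : ∀ z ∈ U, p z ≠ 0 := by
  intro w hw hpw
  have notEv {g : ℂ → ℂ} (hg : AnalyticOnNhd ℂ g U) (hg0 : g z₀ ≠ 0) :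
      ¬ ∀ᶠ z in 𝓝 w, g z = 0 := fun hev =>
    hg0 (hg.eqOn_zero_of_preconnected_of_eventuallyEq_zero hU hw hev h0)
  obtain ⟨m, q, hq, hqw, hpq⟩ :=
    (hp w hw).exists_eventuallyEq_pow_smul_nonzero_iff.2 (notEv hp hp0)
  obtain ⟨k, s, hs, hsw, hHs⟩ :=
    (hH w hw).exists_eventuallyEq_pow_smul_nonzero_iff.2 (notEv hH hH0)
  obtain ⟨m, rfl⟩ : ∃ m', m = m' + 1 := by
    refine Nat.exists_eq_succ_of_ne_zero fun hm => ?_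
    have := hpq.self_of_nhds
    rw [hm, hpw] at this
    exact hqw (by simpa using this.symm)
  have hpd : ∀ᶠ z in 𝓝 w, deriv p z =
      (m + 1) * (z - w) ^ m * q z + (z - w) ^ (m + 1) * deriv q z := by
    filter_upwards [hpq.eventually_nhds, hq.eventually_analyticAt] with z hz hqz
    have hd : HasDerivAt (fun z => (z - w) ^ (m + 1) • q z) (((m + 1 : ℕ) * (z - w) ^ m * 1) * q z +
        (z - w) ^ (m + 1) * deriv q z) z :=
      (((hasDerivAt_id z).sub_const w).fun_pow (m + 1)).mul hqz.differentiableAt.hasDerivAt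
    rw [EventuallyEq.deriv_eq hz, hd.deriv]
    push_cast; ring
  -- The extra factor z - w covers k = 0, where the exponent k - 1 is truncated.
  have hHd : ∀ᶠ z in 𝓝 w, (z - w) * deriv H z =
      k * (z - w) ^ k * s z + (z - w) ^ (k + 1) * deriv s z := by
    filter_upwards [hHs.eventually_nhds, hs.eventually_analyticAt] with z hz hsz
    have hd : HasDerivAt (fun z => (z - w) ^ k • s z) ((k * (z - w) ^ (k - 1) * 1) * s z +
        (z - w) ^ k * deriv s z) z :=
      (((hasDerivAt_id z).sub_const w).fun_pow k).mul hsz.differentiableAt.hasDerivAt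
    rw [EventuallyEq.deriv_eq hz, hd.deriv]
    cases k with
    | zero => simp
    | succ k => simp only [Nat.add_sub_cancel]; push_cast; ring
  -- `T` is z - w times the left side of the equation, divided by (z - w)^(m+k+1). It vanishes off
  -- `w`, hence at `w`, but its value there is (λ(m+1) + k) q(w) s(w) ≠ 0.
  let T : ℂ → ℂ := fun z => lam * ((m + 1) * q z + (z - w) * deriv q z) * s z +
    q z * (k * s z + (z - w) * deriv s z)
  have hT : ContinuousAt T w := by
    have h1 := hq.continuousAt
    have h2 := hs.continuousAt
    have h3 := hq.deriv.continuousAt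
    have h4 := hs.deriv.continuousAt
    fun_prop
  have hTz : ∀ᶠ z in 𝓝[≠] w, T z = 0 := by
    filter_upwards [nhdsWithin_le_nhds hpq, nhdsWithin_le_nhds hHs, nhdsWithin_le_nhds hpd,
      nhdsWithin_le_nhds hHd, nhdsWithin_le_nhds (hUo.mem_nhds hw), self_mem_nhdsWithin]
      with z h1 h2 h3 h4 h5 h6
    have h7 : z - w ≠ 0 := sub_ne_zero.2 h6
    have h8 : (z - w) ^ (m + k + 1) ≠ 0 := pow_ne_zero _ h7
    refine (mul_eq_zero.1 ?_).resolve_left h8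
    have h9 := hode z h5
    have h10 : (z - w) * (lam * deriv p z * H z + p z * deriv H z) = 0 := by rw [h9, mul_zero]
    rw [mul_add, mul_left_comm (z - w) (p z), h4, h3, h1, h2] at h10
    simp only [smul_eq_mul] at h10
    rw [← h10]
    simp only [T]
    ring
  have hTw : T w = 0 := by
    have h1 : Tendsto T (𝓝[≠] w) (𝓝 (T w)) := hT.tendsto.mono_left nhdsWithin_le_nhds
    exact tendsto_nhds_unique h1 (tendsto_const_nhds.congr' (hTz.mono fun z hz => hz.symm))
  have : T w = (lam * (m + 1) + k : ℝ) * (q w * s w) := by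
    simp only [T]; push_cast; ring
  rw [this] at hTw
  have hpos : (lam * (m + 1) + k : ℝ) ≠ 0 := by positivity
  exact (mul_ne_zero (Complex.ofReal_ne_zero.2 hpos) (mul_ne_zero hqw hsw)) hTw

end

/-! ### The two implications. -/

section

variable {f : ℂ → ℂ} {ζ : ℂ} {lam : ℝ}

theorem volume_image_div_sub_eq_zero {a d : ℂ} {T : Set ℂ} (hT : volume T = 0) :
    volume ((fun w => (w - a) / d) '' T) = 0 :=
  addHaar_image_eq_zero_of_differentiableOn_of_addHaar_eq_zero volume
    (fun w _ => by fun_prop) hT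

theorem volume_compl_image_div_sub_eq_zero_iff {a d : ℂ} (hd : d ≠ 0) (S : Set ℂ) :
    volume ((fun w => (w - a) / d) '' S)ᶜ = 0 ↔ volume Sᶜ = 0 := by
  have hbij : Function.Bijective fun w : ℂ => (w - a) / d := by
    refine ⟨fun x y hxy => ?_, fun y => ⟨y * d + a, by field_simp; ring⟩⟩
    simpa [div_left_inj' hd] using hxy
  rw [← Set.image_compl_eq hbij]
  refine ⟨fun h => ?_, volume_image_div_sub_eq_zero⟩
  -- The inverse map v ↦ dv + a, written in the same form (v - a')/d'.
  have := volume_image_div_sub_eq_zero (a := -a / d) (d := d⁻¹) h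
  rw [Set.image_image] at this
  have hid : (fun w : ℂ => ((w - a) / d - -a / d) / d⁻¹) = id := by
    ext w
    simp only [id]
    field_simp
    ring
  rwa [hid, Set.image_id] at this

/-- For univalent functions, equality in Prawitz's inequality characterizes full mappings. -/
theorem fullMapping_iff_hasSum (hlam : 0 < lam) (hf : LocallyUnivalent f)
    (hinj : Set.InjOn f disk) (hζ : ζ ∈ disk) :
    FullMapping f ↔ HasSum (fun n : ℕ =>
      (((n + 1 : ℕ) : ℝ) - lam) * ‖prawitzCoeff lam f ζ (n + 1)‖ ^ 2) lam := by
  have hd := hf.2 ζ hζ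
  have hζ1 : ‖ζ‖ < 1 := by simpa [disk] using hζ
  have hmem : ∀ z ∈ ball (0 : ℂ) 1, mobius ζ z ∈ disk := fun z hz => by
    simpa [disk] using norm_mobius_lt_one hζ1 (by simpa using hz)
  have hmm : ∀ z, ‖z‖ < 1 → mobius (-ζ) (mobius ζ z) = z := fun z hz => by
    simpa using mobius_neg_mobius (ζ := -ζ) (by simpa using hζ1) hz
  set d : ℂ := (1 - (‖ζ‖ : ℂ) ^ 2) * deriv f ζ with hddef
  have hd0 : d ≠ 0 := mul_ne_zero (one_sub_norm_sq_ne_zero hζ1) hd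
  have hp := analyticOnNhd_koebeQuotient hf.1 hζ1 hd
  have hF : ∀ z ∈ ball (0 : ℂ) 1, z * koebeQuotient f ζ z = (f (mobius ζ z) - f ζ) / d :=
    fun z hz => mul_koebeQuotient hζ1 (by simpa using hz) hd
  have hFinj : Set.InjOn (fun z => z * koebeQuotient f ζ z) (ball 0 1) := by
    intro x hx y hy hxy
    simp only [hF x hx, hF y hy, div_left_inj' hd0, sub_left_inj] at hxy
    have h1 := hinj (hmem x hx) (hmem y hy) hxy
    rw [← hmm x (by simpa using hx), h1, hmm y (by simpa using hy)]
  have h00 : (0 : ℂ) ∈ ball (0 : ℂ) 1 := by simp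
  have hne : ∀ z ∈ ball (0 : ℂ) 1, koebeQuotient f ζ z ≠ 0 := by
    intro z hz h0
    have : z = 0 := hFinj hz h00 (by simp [h0])
    rw [this, koebeQuotient_zero hd] at h0
    exact one_ne_zero h0
  obtain ⟨L, hL, hL0, hexp⟩ := exists_log_of_ne_zero hp (koebeQuotient_zero hd) hne
  have hcoef := prawitzCoeff_eq_taylorCoeff lam hf.1 hζ1 hd (hL 0 h00).continuousAt hL0
    (by filter_upwards [isOpen_ball.mem_nhds h00] with z hz using hexp z hz)
  have hFL : ∀ z ∈ ball (0 : ℂ) 1, z * Complex.exp (L z) = (f (mobius ζ z) - f ζ) / d :=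
    fun z hz => by rw [hexp z hz, hF z hz]
  have hLinj : Set.InjOn (fun z => z * Complex.exp (L z)) (ball 0 1) := by
    refine hFinj.congr fun z hz => ?_
    simp only [hexp z hz]
  have himg : (fun z => z * Complex.exp (L z)) '' ball 0 1 =
      (fun w => (w - f ζ) / d) '' (f '' disk) := by
    rw [Set.image_congr hFL]
    ext w
    constructor
    · rintro ⟨z, hz, rfl⟩
      exact ⟨_, ⟨_, hmem z hz, rfl⟩, rfl⟩
    · rintro ⟨_, ⟨u, hu, rfl⟩, rfl⟩
      have hu : ‖u‖ < 1 := by simpa [disk] using hu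
      refine ⟨mobius (-ζ) u, ?_, ?_⟩
      · simpa using norm_mobius_lt_one (ζ := -ζ) (by simpa using hζ1) hu
      · simp only [mobius_neg_mobius hζ1 hu]
  obtain ⟨I, hI, hsum⟩ := exists_hasSum_area hlam hL hLinj
  -- The dropped term n = 0 equals -λ because a_0 = 1, so the remaining sum is λ - I.
  have hsum' := (hasSum_nat_add_iff' 1).2 hsum
  simp only [← hcoef] at hsum'
  have hzero : prawitzCoeff lam f ζ 0 = 1 := by
    rw [hcoef]; simp [taylorCoeff, hL0]
  have hval : -I - ∑ i ∈ range 1, ((i : ℝ) - lam) * ‖prawitzCoeff lam f ζ i‖ ^ 2 = lam - I := by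
    simp [hzero]; ring
  rw [hval] at hsum'
  rw [FullMapping, ← volume_compl_image_div_sub_eq_zero_iff (a := f ζ) hd0, ← himg, ← hI]
  constructor
  · rintro rfl
    simpa using hsum'
  · intro h
    linarith [h.unique hsum']

/-- If the coefficient series converges, its sum function extends the generating function to the
whole disk, so the Koebe transform has no zeros away from the origin. -/
theorem koebeQuotient_ne_zero_of_summable (hlam : 0 < lam) (hf : LocallyUnivalent f)
    (hζ : ζ ∈ disk)
    (hs : Summable fun n : ℕ =>
      (((n + 1 : ℕ) : ℝ) - lam) * ‖prawitzCoeff lam f ζ (n + 1)‖ ^ 2) :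
    ∀ z ∈ ball (0 : ℂ) 1, koebeQuotient f ζ z ≠ 0 := by
  have hd := hf.2 ζ hζ
  have hζ1 : ‖ζ‖ < 1 := by simpa [disk] using hζ
  have hp := analyticOnNhd_koebeQuotient hf.1 hζ1 hd
  have hp0 := koebeQuotient_zero (ζ := ζ) hd
  set p := koebeQuotient f ζ with hpdef
  have h00 : (0 : ℂ) ∈ ball (0 : ℂ) 1 := by simp
  let L : ℂ → ℂ := fun z => Complex.log (p z)
  have hLa : AnalyticAt ℂ L 0 := (hp 0 h00).clog (by simp [hp0])
  have hpne : ∀ᶠ z in 𝓝 0, p z ≠ 0 := (hp 0 h00).continuousAt.eventually_ne (by simp [hp0])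
  have hexp : ∀ᶠ z in 𝓝 0, Complex.exp (L z) = p z := hpne.mono fun z hz => Complex.exp_log hz
  have hcoef := prawitzCoeff_eq_taylorCoeff lam hf.1 hζ1 hd hLa.continuousAt (by simp [L, hp0]) hexp
  set a : ℕ → ℂ := prawitzCoeff lam f ζ with ha
  set G : ℂ → ℂ := fun z => Complex.exp (-lam * L z) with hG
  have hGa : AnalyticAt ℂ G 0 := (analyticAt_const.fun_mul hLa).cexp
  have hGs : HasFPowerSeriesAt G (FormalMultilinearSeries.ofScalars ℂ a) 0 := by
    have := hGa.hasFPowerSeriesAt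
    rwa [show (fun n => iteratedDeriv n G 0 / n.factorial) = a from
      funext fun n => (hcoef n).symm] at this
  -- The terms of the series tend to 0 and their weights are eventually at least 1. Bounded
  -- coefficients give radius of convergence at least 1.
  have hbound : ∀ᶠ n in atTop, ‖a n‖ ≤ 1 := by
    obtain ⟨N, hN⟩ := exists_nat_ge (lam + 1)
    have h1 := hs.tendsto_atTop_zero.eventually_le_const one_pos
    have h2 : ∀ᶠ n in atTop, ‖a (n + 1)‖ ≤ 1 := by
      filter_upwards [h1, eventually_ge_atTop N] with n hn hnN
      have h3 : (N : ℝ) ≤ n := by exact_mod_cast hnN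
      have h4 : (1 : ℝ) ≤ ((n + 1 : ℕ) : ℝ) - lam := by push_cast; linarith
      have h5 : ‖a (n + 1)‖ ^ 2 ≤ 1 :=
        (le_mul_of_one_le_left (sq_nonneg _) h4).trans hn
      exact (sq_le_one_iff₀ (norm_nonneg _)).1 h5
    obtain ⟨M, hM⟩ := eventually_atTop.1 h2
    refine eventually_atTop.2 ⟨M + 1, fun n hn => ?_⟩
    obtain ⟨n, rfl⟩ : ∃ k, n = k + 1 := ⟨n - 1, by omega⟩
    exact hM n (by omega)
  have hrad : 1 ≤ (FormalMultilinearSeries.ofScalars ℂ a).radius := by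
    refine FormalMultilinearSeries.le_radius_of_eventually_le (r := 1) _ 1 ?_
    filter_upwards [hbound] with n hn
    simpa [FormalMultilinearSeries.ofScalars_norm] using hn
  have hHs := (FormalMultilinearSeries.ofScalars ℂ a).hasFPowerSeriesOnBall
    (zero_lt_one.trans_le hrad)
  set H := (FormalMultilinearSeries.ofScalars ℂ a).sum with hHdef
  have hHa : AnalyticOnNhd ℂ H (ball 0 1) := by
    refine hHs.analyticOnNhd.mono ?_
    rw [← Metric.eball_ofReal, ENNReal.ofReal_one]
    exact Metric.eball_subset_eball hrad
  have hHG : H =ᶠ[𝓝 0] G := by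
    filter_upwards [hasFPowerSeriesAt_iff.1 hGs, hasFPowerSeriesAt_iff.1 hHs.hasFPowerSeriesAt]
      with z h1 h2
    simpa using h2.unique h1
  -- Logarithmic differentiation of H = p^(-λ). Unlike that formula, the equation needs no branch
  -- and extends to the whole disk.
  have hloc : (fun z => lam * deriv p z * H z + p z * deriv H z) =ᶠ[𝓝 0] 0 := by
    filter_upwards [hHG, hHG.eventually_nhds, hpne, hLa.eventually_analyticAt,
      hexp.eventually_nhds, isOpen_ball.mem_nhds h00] with z h1 h2 h3 h4 h5 h6
    have h7 : deriv H z = G z * (-lam * deriv L z) := by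
      rw [EventuallyEq.deriv_eq h2]
      exact (h4.differentiableAt.hasDerivAt.const_mul (-(lam : ℂ))).cexp.deriv
    have h8 : deriv p z = p z * deriv L z := by
      have h9 : (fun z => Complex.exp (L z)) =ᶠ[𝓝 z] p := h5
      rw [← h9.deriv_eq, h4.differentiableAt.hasDerivAt.cexp.deriv, h5.self_of_nhds]
    rw [h7, h8, h1]
    simp
    ring
  have hode : AnalyticOnNhd ℂ (fun z => lam * deriv p z * H z + p z * deriv H z) (ball 0 1) :=
    fun z hz => ((analyticAt_const.fun_mul (hp.deriv z hz)).fun_mul (hHa z hz)).fun_add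
      ((hp z hz).fun_mul (hHa.deriv z hz))
  have hpre := (convex_ball (0 : ℂ) 1).isPreconnected
  refine ne_zero_of_mul_deriv_add_eq_zero hlam isOpen_ball hpre hp hHa h00 (by simp [hp0]) ?_
    (hode.eqOn_zero_of_preconnected_of_eventuallyEq_zero hpre h00 hloc)
  rw [hHG.self_of_nhds]
  exact Complex.exp_ne_zero _

/-- If f(w) = f(ζ) with w ≠ ζ, the Koebe quotient based at `ζ` vanishes at the preimage of `w` under
the automorphism. This is where all base points are needed. -/
theorem injOn_of_forall_summable (hlam : 0 < lam) (hf : LocallyUnivalent f)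
    (hs : ∀ ζ ∈ disk, Summable fun n : ℕ =>
      (((n + 1 : ℕ) : ℝ) - lam) * ‖prawitzCoeff lam f ζ (n + 1)‖ ^ 2) :
    Set.InjOn f disk := by
  intro ζ hζ w hw hfw
  by_contra hne
  have hζ1 : ‖ζ‖ < 1 := by simpa [disk] using hζ
  have hw1 : ‖w‖ < 1 := by simpa [disk] using hw
  have hz := norm_mobius_lt_one (ζ := -ζ) (by simpa using hζ1) hw1
  refine koebeQuotient_ne_zero_of_summable hlam hf hζ (hs ζ hζ) (mobius (-ζ) w) (by simpa using hz) ?_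
  rw [koebeQuotient, mobius_neg_mobius hζ1 hw1, dslope_of_ne _ (Ne.symm hne), slope_def_field,
    hfw, sub_self, zero_div, zero_div]

end

end PrawitzCriterion

/-- The unconditional summation in `HasSum` agrees with ordinary convergence here, as the terms are
nonnegative once n + 1 ≥ λ. -/
theorem theorem2p5 (lam : ℝ) (hlam : 0 < lam) (f : ℂ → ℂ)
    (hf : PrawitzCriterion.LocallyUnivalent f) :
    (PrawitzCriterion.Univalent f ∧ PrawitzCriterion.FullMapping f) ↔
      ∀ ζ ∈ PrawitzCriterion.disk,
        HasSum (fun n : ℕ =>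
          (((n + 1 : ℕ) : ℝ) - lam) * ‖PrawitzCriterion.prawitzCoeff lam f ζ (n + 1)‖ ^ 2) lam := by
  constructor
  · rintro ⟨⟨_, hinj⟩, hfull⟩ ζ hζ
    exact (PrawitzCriterion.fullMapping_iff_hasSum hlam hf hinj hζ).1 hfull
  · intro h
    have hinj := PrawitzCriterion.injOn_of_forall_summable hlam hf fun ζ hζ => (h ζ hζ).summable
    have h0 : (0 : ℂ) ∈ PrawitzCriterion.disk := by simp [PrawitzCriterion.disk]
    -- Once univalence is known, equality at a single base point yields fullness.
    exact ⟨⟨hf.1, hinj⟩, (PrawitzCriterion.fullMapping_iff_hasSum hlam hf hinj h0).2 (h 0 h0)⟩
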